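/- Let $(z,w)=(z_1,z_2,w)$ be the coordinates of $\mathbb C^3$ and let $M\subset\mathbb C^3$ be a $4$-dimensional real analytic submanifold which near $0$ is given by $$w=2\,\mathrm{Re}\,(z\,\mathcal A\,z^t)+z\,\mathcal B\,\bar z^t+E(z,\bar z),$$ where $E$ is a complex-valued real analytic function near $0$ with $E=O(|z|^3)$ and the pair of $2\times2$ complex matrices $\{\mathcal A,\mathcal B\}$ has one of the following forms: (A) $\mathcal B=\begin{pmatrix}1&0\\0&1\end{pmatrix}$, $\mathcal A=\begin{pmatrix}\lambda_1&0\\0&\lambda_2\end{pmatrix}$, where $\lambda_1,\lambda_2\ge 0$, and $\lambda_1\ne\frac12$ or $\lambda_2\neq\frac12$; (B) $\mathcal B=\begin{pmatrix}1&0\\0&-1\end{pmatrix}$, $\mathcal A=\begin{pmatrix}\lambda_1&0\\0&\lambda_2\end{pmatrix}$, where $0\le\lambda_1\le\lambda_2$, and $\lambda_1<\frac12$ or $\frac12\le\lambda_1<\lambda_2$; (C) $\mathcal B=\begin{pmatrix}1&0\\0&-1\end{pmatrix}$, $\mathcal A=\begin{pmatrix}0&\lambda\\\lambda&0\end{pmatrix}$,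 $\lambda>0$; (D) $\mathcal B=\begin{pmatrix}1&0\\0&-1\end{pmatrix}$, $\mathcal A=\begin{pmatrix}\frac12&\frac12\\\frac12&\frac12\end{pmatrix}$; (E) $\mathcal B=\begin{pmatrix}0&1\\1&0\end{pmatrix}$, $\mathcal A=\begin{pmatrix}0&b\\b&\frac12\end{pmatrix}$, $b>0$; (F) $\mathcal B=\begin{pmatrix}0&1\\1&0\end{pmatrix}$, $\mathcal A=\begin{pmatrix}\frac12&0\\0&d\end{pmatrix}$, $d\in\mathbb C$, $\mathrm{Im}\,d>0$. For a real submanifold $S$ of a complex vector space and $p\in S$, let $Rk(p)=\dim_{\mathbb C}T^{(1,0)}_pS$; $p$ is a CR point of $S$ if $Rk$ is constant on $S$ near $p$, and a CR singular point otherwise. A real surface $S\subset\mathbb C^2$ has a complex tangent point at $p$ if $T_pS$ is a complex line, and the point is elliptic if, after a local biholomorphic change of coordinates sending $p$ to $0$, $S$ is given near $0$ by $w=|\xi|^2+\lambda(\xi^2+\bar\xi^2)+o(|\xi|^2)$ with smooth right-hand side and $0\le\lambda<\frac12$. Then $0$ is a CR singular point of $M$, and $M$ has an elliptic direction at $0$,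 that is, there is $\vec c\in\mathbb C^2\setminus\{0\}$ such that $M\cap\{z=\vec c\,\xi:\ \xi\in\mathbb C\}$, regarded as a real surface in the $(\xi,w)$-plane, has an elliptic complex tangent point at $0$. Moreover, there is $\vec a\in\mathbb C^2$, linearly independent of $\vec c$, such that the following holds for the affine complex planes $V(\tau)=\{(z,w): z=\vec c\,\xi+\vec a\,\tau,\ \xi,w\in\mathbb C\}$, $\tau\in\mathbb C$. For every $\tau\approx0$ the real surface $M\cap V(\tau)$ in the $(\xi,w)$-plane has, in a fixed neighbourhood of $0$, exactly one complex tangent point $P(\tau)$; it is elliptic, and $P(\tau)\to P(0)=0$ as $\tau\to0$. For generic $\tau\approx0$, i.e. for all $\tau$ in some disc around $0$ outside a proper real analytic subset of the disc, $P(\tau)$ is a CR point of $M$, and no holomorphic curve contained in $M$ passes through $P(\tau)$; that is, there is no germ of a nonconstant holomorphic map $\gamma:(\mathbb C,0)\to(\mathbb C^3,P(\tau))$ with values in $M$. -/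

import Mathlib

open Filter Topology Asymptotics
open scoped ContDiff ComplexConjugate Matrix

noncomputable section

/-- The `(z, w)`-space `ℂ² × ℂ = ℂ³`, with `z = (z₁, z₂)`. (The norm is only used up to
equivalence of norms.) -/
abbrev CThree : Type := (Fin 2 → ℂ) × ℂ

/-- The holomorphic tangent space of `S` at `p`: the vectors `v` such that both `v` and `i v` are
real tangent vectors of `S` at `p`. For a real submanifold `S` the tangent cone is the real
tangent space `T_p S`, so this is `T_p S ∩ i T_p S`, which is identified with `T_p^{(1,0)} S` as a
complex vector space. -/
def holTangentSpace {X : Type*} [NormedAddCommGroup X] [NormedSpace ℂ X] [NormedSpace ℝ X]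
    [IsScalarTower ℝ ℂ X] (S : Set X) (p : X) : Submodule ℂ X :=
  Submodule.span ℂ {v : X | v ∈ tangentConeAt ℝ S p ∧ Complex.I • v ∈ tangentConeAt ℝ S p}

/-- `Rk(p) = dim_ℂ T_p^{(1,0)} S`. -/
def crRank {X : Type*} [NormedAddCommGroup X] [NormedSpace ℂ X] [NormedSpace ℝ X]
    [IsScalarTower ℝ ℂ X] (S : Set X) (p : X) : ℕ :=
  Module.finrank ℂ (holTangentSpace S p)

/-- `p` is a CR point of `S`: the rank `Rk` is constant on `S` near `p`. -/
def IsCRPoint {X : Type*} [NormedAddCommGroup X] [NormedSpace ℂ X] [NormedSpace ℝ X]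
    [IsScalarTower ℝ ℂ X] (S : Set X) (p : X) : Prop :=
  p ∈ S ∧ ∀ᶠ q in 𝓝[S] p, crRank S q = crRank S p

/-- `p` is a CR singular point of `S`. -/
def IsCRSingularPoint {X : Type*} [NormedAddCommGroup X] [NormedSpace ℂ X] [NormedSpace ℝ X]
    [IsScalarTower ℝ ℂ X] (S : Set X) (p : X) : Prop :=
  p ∈ S ∧ ¬ IsCRPoint S p

/-- `p` is a complex tangent point of the real surface `S ⊂ ℂ²`: the tangent plane of `S` at `p`
is a complex line. -/
def IsComplexTangentPoint (S : Set (ℂ × ℂ)) (p : ℂ × ℂ) : Prop :=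
  p ∈ S ∧ crRank S p = 1

/-- The real surface `S ⊂ ℂ²` has an elliptic complex tangent point at `p` in the sense of Bishop:
after a local biholomorphic change of coordinates `Φ` sending `p` to `0`, `S` is near `0` the
graph of a smooth function `h(ξ) = |ξ|² + l (ξ² + ξ̄²) + o(|ξ|²)` with `0 ≤ l < 1/2`. -/
def IsEllipticPoint (S : Set (ℂ × ℂ)) (p : ℂ × ℂ) : Prop :=
  p ∈ S ∧
  ∃ (Φ : ℂ × ℂ → ℂ × ℂ) (h : ℂ → ℂ) (l : ℝ),
    AnalyticAt ℂ Φ p ∧ Φ p = 0 ∧ (fderiv ℂ Φ p).IsInvertible ∧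
    ContDiffAt ℝ ∞ h 0 ∧ 0 ≤ l ∧ l < 1 / 2 ∧
    ((fun ξ : ℂ => h ξ - ((‖ξ‖ : ℂ) ^ 2 + (l : ℂ) * (ξ ^ 2 + conj ξ ^ 2)))
      =o[𝓝 0] fun ξ : ℂ => ‖ξ‖ ^ 2) ∧
    ∀ᶠ x in 𝓝 p, x ∈ S ↔ (Φ x).2 = h (Φ x).1

/-- The parametrization, by its coordinates `(ξ, w)`, of the affine complex plane
`V(τ) = {(z, w) : z = c ξ + a τ, ξ ∈ ℂ, w ∈ ℂ}`. -/
def planeEmb (c a : Fin 2 → ℂ) (τ : ℂ) (x : ℂ × ℂ) : CThree :=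
  (x.1 • c + τ • a, x.2)

/-- `M ∩ V(τ)`, regarded as a subset of the `(ξ, w)`-plane. -/
def planeSlice (M : Set CThree) (c a : Fin 2 → ℂ) (τ : ℂ) : Set (ℂ × ℂ) :=
  {x | planeEmb c a τ x ∈ M}

/-- `c ≠ 0` is an elliptic direction of `M` at the CR singular point `0`: the surface
`M ∩ {z = c ξ}` of the `(ξ, w)`-plane has an elliptic complex tangent point at `0`. -/
def IsEllipticDirection (M : Set CThree) (c : Fin 2 → ℂ) : Prop :=
  IsCRSingularPoint M 0 ∧ c ≠ 0 ∧ IsEllipticPoint (planeSlice M c 0 0) 0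

/-- There is a (possibly singular) holomorphic curve through `p` that is contained in `S`: a germ
of a nonconstant holomorphic map `γ : (ℂ, 0) → (X, p)` with values in `S`. -/
def HasHolomorphicCurveThrough {X : Type*} [NormedAddCommGroup X] [NormedSpace ℂ X]
    (S : Set X) (p : X) : Prop :=
  ∃ γ : ℂ → X, AnalyticAt ℂ γ 0 ∧ γ 0 = p ∧ (∀ᶠ ζ in 𝓝 0, γ ζ ∈ S) ∧
    ¬ ∀ᶠ ζ in 𝓝 0, γ ζ = p

/-- `Q τ` holds for generic `τ ≈ 0`: on some disc around `0` it holds off a proper real analytic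
subset. -/
def GenericNearZero (Q : ℂ → Prop) : Prop :=
  ∃ (δ : ℝ) (g : ℂ → ℝ), 0 < δ ∧ AnalyticOnNhd ℝ g (Metric.ball 0 δ) ∧
    (∃ τ ∈ Metric.ball (0 : ℂ) δ, g τ ≠ 0) ∧
    ∀ τ ∈ Metric.ball (0 : ℂ) δ, g τ ≠ 0 → Q τ

/-- The quadratic form `2 Re (z A zᵗ) + z B z̄ᵗ`. -/
def quadForm (A B : Matrix (Fin 2) (Fin 2) ℂ) (z : Fin 2 → ℂ) : ℂ :=
  2 * (((z ⬝ᵥ (A *ᵥ z)).re : ℝ) : ℂ) + z ⬝ᵥ (B *ᵥ star z)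

/-- The normal forms (A)-(F) of the pair `{A, B}`, in this order. -/
def IsCoffmanForm (A B : Matrix (Fin 2) (Fin 2) ℂ) : Prop :=
  (B = !![1, 0; 0, 1] ∧ ∃ l₁ l₂ : ℝ, A = !![(l₁ : ℂ), 0; 0, (l₂ : ℂ)] ∧
    0 ≤ l₁ ∧ 0 ≤ l₂ ∧ (l₁ ≠ 1 / 2 ∨ l₂ ≠ 1 / 2)) ∨
  (B = !![1, 0; 0, -1] ∧ ∃ l₁ l₂ : ℝ, A = !![(l₁ : ℂ), 0; 0, (l₂ : ℂ)] ∧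
    0 ≤ l₁ ∧ l₁ ≤ l₂ ∧ (l₁ < 1 / 2 ∨ (1 / 2 ≤ l₁ ∧ l₁ < l₂))) ∨
  (B = !![1, 0; 0, -1] ∧ ∃ l : ℝ, A = !![0, (l : ℂ); (l : ℂ), 0] ∧ 0 < l) ∨
  (B = !![1, 0; 0, -1] ∧ A = !![1 / 2, 1 / 2; 1 / 2, 1 / 2]) ∨
  (B = !![0, 1; 1, 0] ∧ ∃ b : ℝ, A = !![0, (b : ℂ); (b : ℂ), 1 / 2] ∧ 0 < b) ∨
  (B = !![0, 1; 1, 0] ∧ ∃ d : ℂ, A = !![1 / 2, 0; 0, d] ∧ 0 < d.im)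

end

/-! ### The antilinear part of a real linear functional. -/

section AntilinearPart

variable {Z : Type*} [NormedAddCommGroup Z] [NormedSpace ℂ Z] [NormedSpace ℝ Z]

/-! Write M near 0 as the graph of F = `quadForm A B` + E. Everything is read off from the
antilinear part of dF (∂̄F, up to a factor) and from the second derivative H of F. The holomorphic
tangent space of a graph projects isomorphically onto the kernel of ∂̄F, so complex tangents are
zeros of ∂̄F, and a complex tangent of a surface is elliptic when |f_ξ̄ξ̄| < |f_ξξ̄|
(`isEllipticPoint_graph`). Since E does not affect the 2-jet at 0, the direction c is elliptic as
soon as 2|cAcᵗ| < |cBc̄ᵗ|; each normal form admits such a c (`IsCoffmanForm.exists_direction`).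

The same inequality makes ξ ↦ ∂̄_c dF(ξc + τa) invertible to first order, so the implicit function
theorem gives one complex tangent ξ = p(τ) per slice. Ellipticity is an open condition and persists
for small τ.

Put ζ(τ) = p(τ)c + τa. Then ∂̄F at ζ(τ) kills c, and ζ(τ) gives a CR point whenever ∂̄F does not
kill a. If it killed a for all small τ, differentiating at 0 would put the real 2-plane ζ'(0)(ℂ)
into the real kernel of the linearized ∂̄F, which has dimension at most one
(`IsCoffmanForm.exists_functional`).

At such a point the holomorphic tangent space lies over ℂc, where ellipticity makes the Levi form
nonzero. A holomorphic curve in M would have Levi-null velocities, a contradiction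
(`not_hasHolomorphicCurveThrough_graph`). -/

lemma smul_eq_re_smul_add_im_smul [IsScalarTower ℝ ℂ Z] (s : ℂ) (u : Z) :
    s • u = s.re • u + s.im • (Complex.I • u) := by
  conv_lhs => rw [← Complex.re_add_im s, add_smul, mul_smul]
  rw [← algebraMap_smul ℂ s.re u, ← algebraMap_smul ℂ s.im (Complex.I • u)]
  rfl

/-- Twice the antilinear part of a real linear functional `D`; it vanishes iff `D` is complex
linear. For `D` the differential of `F` at a point it is `2 ∂̄F`. -/
noncomputable def antiPart (D : Z →L[ℝ] ℂ) (v : Z) : ℂ := D v + Complex.I * D (Complex.I • v)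

lemma antiPart_add (D : Z →L[ℝ] ℂ) (u v : Z) :
    antiPart D (u + v) = antiPart D u + antiPart D v := by
  simp only [antiPart, smul_add, map_add]; ring

lemma antiPart_smul [IsScalarTower ℝ ℂ Z] (D : Z →L[ℝ] ℂ) (s : ℂ) (v : Z) :
    antiPart D (s • v) = conj s * antiPart D v := by
  have hc : conj s = s.re - s.im * Complex.I := by
    apply Complex.ext <;> simp
  have h1 : D (Complex.I • (s • v)) = s.re * D (Complex.I • v) - s.im * D v := by
    rw [smul_comm, smul_eq_re_smul_add_im_smul s, smul_smul, Complex.I_mul_I, neg_one_smul,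
      map_add, D.map_smul, D.map_smul, map_neg, Complex.real_smul, Complex.real_smul]
    ring
  rw [antiPart, h1, antiPart, smul_eq_re_smul_add_im_smul s v, map_add, D.map_smul, D.map_smul, hc,
    Complex.real_smul, Complex.real_smul]
  linear_combination ((s.im : ℂ) * D (Complex.I • v)) * Complex.I_mul_I

/-- The conjugate of `antiPart D`, as a complex linear functional. -/
noncomputable def antiLin [IsScalarTower ℝ ℂ Z] (D : Z →L[ℝ] ℂ) : Z →ₗ[ℂ] ℂ where
  toFun v := conj (antiPart D v)
  map_add' u v := by rw [antiPart_add, map_add]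
  map_smul' s v := by simp [antiPart_smul]

lemma antiLin_eq_zero_iff [IsScalarTower ℝ ℂ Z] (D : Z →L[ℝ] ℂ) (v : Z) : antiLin D v = 0 ↔ antiPart D v = 0 := by
  simp [antiLin]

lemma antiPart_eq_zero_iff (D : Z →L[ℝ] ℂ) (v : Z) :
    antiPart D v = 0 ↔ Complex.I * D v = D (Complex.I • v) := by
  unfold antiPart
  constructor <;> intro h
  · linear_combination Complex.I * h - D (Complex.I • v) * Complex.I_mul_I
  · linear_combination -Complex.I * h + D v * Complex.I_mul_I

end AntilinearPart

/-! ### Tangent cone and CR rank of a graph. -/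

section GraphTangent

/-- Derivatives map tangent cones to tangent cones. Applied to q ↦ q.2 - F q.1, which sends the
graph to a single point, this gives one inclusion; applied to u ↦ (u, F u), the other. -/
lemma tangentConeAt_graph {Z : Type*} [NormedAddCommGroup Z] [NormedSpace ℝ Z] {S : Set (Z × ℂ)} {F : Z → ℂ} {D : Z →L[ℝ] ℂ} {p : Z × ℂ}
    (hp : p.2 = F p.1) (hS : ∀ᶠ q in 𝓝 p, q ∈ S ↔ q.2 = F q.1) (hF : HasFDerivAt F D p.1) :
    tangentConeAt ℝ S p = {v | v.2 = D v.1} := by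
  obtain ⟨z, w⟩ := p
  simp only at hp hF
  subst hp
  have hcongr : tangentConeAt ℝ S (z, F z) = tangentConeAt ℝ {q : Z × ℂ | q.2 = F q.1} (z, F z) := by
    apply tangentConeAt_congr
    rw [nhdsWithin_eq_iff_eventuallyEq]
    exact hS.mono fun q hq => propext hq
  rw [hcongr]
  apply Set.Subset.antisymm
  · intro v hv
    have hG : HasFDerivAt (fun q : Z × ℂ => q.2 - F q.1)
        (ContinuousLinearMap.snd ℝ Z ℂ - D.comp (ContinuousLinearMap.fst ℝ Z ℂ)) (z, F z) :=
      hasFDerivAt_snd.sub (HasFDerivAt.comp (z, F z) (g := F) hF hasFDerivAt_fst)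
    have h1 := hG.hasFDerivWithinAt.mapsTo_tangent_cone (s := {q : Z × ℂ | q.2 = F q.1}) hv
    have h2 : ((fun q : Z × ℂ => q.2 - F q.1) '' {q : Z × ℂ | q.2 = F q.1}) ⊆ {0} := by
      rintro _ ⟨q, hq, rfl⟩
      simpa [sub_eq_zero] using hq
    have h3 := tangentConeAt_mono (𝕜 := ℝ) h2 h1
    have h4 := tangentConeAt_subset_zero (𝕜 := ℝ) (s := {(0 : ℂ)}) (x := F z - F z) (by
      rw [accPt_iff_frequently]
      simp only [sub_self, Set.mem_singleton_iff, ne_eq, not_frequently]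
      exact Eventually.of_forall fun y hy => hy.1 hy.2) h3
    simpa [sub_eq_zero] using h4
  · intro v hv
    have hG : HasFDerivAt (fun u : Z => (u, F u)) ((ContinuousLinearMap.id ℝ Z).prod D) z :=
      (hasFDerivAt_id z).prodMk hF
    have h1 := hG.hasFDerivWithinAt.mapsTo_tangent_cone (s := Set.univ) (x := z)
      (show v.1 ∈ _ by rw [tangentConeAt_univ]; trivial)
    have h2 : ((fun u : Z => (u, F u)) '' Set.univ) ⊆ {q : Z × ℂ | q.2 = F q.1} := by
      rintro _ ⟨q, -, rfl⟩; rfl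
    have h3 := tangentConeAt_mono (𝕜 := ℝ) h2 h1
    have : ((ContinuousLinearMap.id ℝ Z).prod D) v.1 = v := by
      ext1
      · rfl
      · exact hv.symm
    rwa [this] at h3

variable {Z : Type*} [NormedAddCommGroup Z] [NormedSpace ℂ Z] [NormedSpace ℝ Z]
  [IsScalarTower ℝ ℂ Z]

/-- On the kernel of the antilinear part D is complex linear, so the vectors (v, D v) over that
kernel already form a complex subspace and taking the span adds nothing. -/
lemma crRank_graph {S : Set (Z × ℂ)} {F : Z → ℂ} {D : Z →L[ℝ] ℂ} {p : Z × ℂ}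
    (hp : p.2 = F p.1) (hS : ∀ᶠ q in 𝓝 p, q ∈ S ↔ q.2 = F q.1) (hF : HasFDerivAt F D p.1) :
    crRank S p = Module.finrank ℂ (LinearMap.ker (antiLin D)) := by
  have hlin : ∀ v ∈ LinearMap.ker (antiLin D), ∀ s : ℂ, D (s • v) = s * D v := by
    intro v hv s
    have hv' := (antiPart_eq_zero_iff D v).1 ((antiLin_eq_zero_iff D v).1 hv)
    rw [smul_eq_re_smul_add_im_smul, map_add, map_smul, map_smul, ← hv']
    conv_rhs => rw [← Complex.re_add_im s]
    simp only [Complex.real_smul]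
    ring
  let L : LinearMap.ker (antiLin D) →ₗ[ℂ] Z × ℂ :=
    { toFun := fun v => (v.1, D v.1)
      map_add' := fun u v => by simp
      map_smul' := fun s v => by
        have := hlin v.1 v.2 s
        simp [this] }
  have hL : Function.Injective L := fun u v h => Subtype.ext (congrArg Prod.fst h)
  have hspan : holTangentSpace S p = LinearMap.range L := by
    have hset : {v : Z × ℂ | v ∈ tangentConeAt ℝ S p ∧ Complex.I • v ∈ tangentConeAt ℝ S p}
        = (LinearMap.range L : Set (Z × ℂ)) := by
      rw [tangentConeAt_graph hp hS hF]
      ext v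
      simp only [Set.mem_ofPred_eq, Prod.smul_fst, Prod.smul_snd, smul_eq_mul, SetLike.mem_coe,
        LinearMap.mem_range]
      constructor
      · rintro ⟨h1, h2⟩
        refine ⟨⟨v.1, ?_⟩, ?_⟩
        · rw [LinearMap.mem_ker, antiLin_eq_zero_iff, antiPart_eq_zero_iff, ← h1, h2]
        · exact Prod.ext rfl h1.symm
      · rintro ⟨u, rfl⟩
        refine ⟨rfl, ?_⟩
        exact (antiPart_eq_zero_iff D u).1 ((antiLin_eq_zero_iff D u).1 u.2)
    unfold holTangentSpace
    rw [hset, Submodule.span_eq]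
  unfold crRank
  rw [hspan, LinearMap.finrank_range_of_inj hL]

lemma crRank_graph_of_antiPart_eq_zero {S : Set (Z × ℂ)} {F : Z → ℂ} {D : Z →L[ℝ] ℂ} {p : Z × ℂ}
    (hp : p.2 = F p.1) (hS : ∀ᶠ q in 𝓝 p, q ∈ S ↔ q.2 = F q.1) (hF : HasFDerivAt F D p.1)
    (h : ∀ v, antiPart D v = 0) : crRank S p = Module.finrank ℂ Z := by
  have : antiLin D = 0 := LinearMap.ext fun v => (antiLin_eq_zero_iff D v).2 (h v)
  rw [crRank_graph hp hS hF, this, LinearMap.ker_zero, finrank_top]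

lemma crRank_graph_of_antiPart_ne_zero [FiniteDimensional ℂ Z] {S : Set (Z × ℂ)} {F : Z → ℂ}
    {D : Z →L[ℝ] ℂ} {p : Z × ℂ} (hp : p.2 = F p.1)
    (hS : ∀ᶠ q in 𝓝 p, q ∈ S ↔ q.2 = F q.1) (hF : HasFDerivAt F D p.1)
    {v : Z} (h : antiPart D v ≠ 0) : crRank S p + 1 = Module.finrank ℂ Z := by
  have : antiLin D ≠ 0 := fun h0 => h ((antiLin_eq_zero_iff D v).1 (by rw [h0]; rfl))
  rw [crRank_graph hp hS hF]
  exact Module.Dual.finrank_ker_add_one_of_ne_zero this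

lemma isComplexTangentPoint_graph_iff {S : Set (ℂ × ℂ)} {f : ℂ → ℂ} {D : ℂ →L[ℝ] ℂ} {p : ℂ × ℂ}
    (hS : ∀ᶠ q in 𝓝 p, q ∈ S ↔ q.2 = f q.1) (hf : HasFDerivAt f D p.1) :
    IsComplexTangentPoint S p ↔ p.2 = f p.1 ∧ antiPart D 1 = 0 := by
  unfold IsComplexTangentPoint
  rw [hS.self_of_nhds]
  refine and_congr_right fun hp => ?_
  constructor
  · intro h
    by_contra h0
    have := crRank_graph_of_antiPart_ne_zero hp hS hf h0
    simp [h] at this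
  · intro h
    rw [crRank_graph_of_antiPart_eq_zero hp hS hf, Module.finrank_self]
    intro v
    have := antiPart_smul D v 1
    rw [smul_eq_mul, mul_one] at this
    rw [this, h, mul_zero]

end GraphTangent

/-! ### Second-order Taylor expansion and Bishop's ellipticity criterion. -/

lemma isLittleO_taylor_two {E G : Type*} [NormedAddCommGroup E] [NormedSpace ℝ E]
    [NormedAddCommGroup G] [NormedSpace ℝ G] {f : E → G} {f' : E → E →L[ℝ] G}
    {H : E →L[ℝ] E →L[ℝ] G} {x : E} (hf : ∀ᶠ y in 𝓝 x, HasFDerivAt f (f' y) y)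
    (hH : HasFDerivAt f' H x) :
    (fun y => f (x + y) - f x - f' x y - (1 / 2 : ℝ) • H y y) =o[𝓝 0] fun y => ‖y‖ ^ 2 := by
  have hsymm : ∀ u v, H u v = H v u := fun u v => second_derivative_symmetric_of_eventually hf hH u v
  have htr : Tendsto (fun y => x + y) (𝓝 0) (𝓝 x) := by
    have : Tendsto (fun y => x + y) (𝓝 0) (𝓝 (x + 0)) := (continuous_const_add x).tendsto 0
    rwa [add_zero] at this
  have hlo := hasFDerivAt_iff_isLittleO_nhds_zero.1 hH
  rw [isLittleO_iff] at hlo ⊢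
  intro ε hε
  obtain ⟨r, hr, hball⟩ := Metric.eventually_nhds_iff_ball.1 ((htr.eventually hf).and (hlo hε))
  filter_upwards [Metric.ball_mem_nhds 0 hr] with y hy
  have hsub : Metric.closedBall (0 : E) ‖y‖ ⊆ Metric.ball 0 r :=
    Metric.closedBall_subset_ball (by simpa using hy)
  have hder : ∀ u ∈ Metric.closedBall (0 : E) ‖y‖,
      HasFDerivWithinAt (fun y => f (x + y) - f x - f' x y - (1 / 2 : ℝ) • H y y)
        (f' (x + u) - f' x - H u) (Metric.closedBall (0 : E) ‖y‖) u := by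
    intro u hu
    have h1 : HasFDerivAt (fun y => f (x + y)) (f' (x + u)) u :=
      (hasFDerivAt_comp_add_left x).2 (hball u (hsub hu)).1
    have h2 : HasFDerivAt (fun y => H y y) ((2 : ℝ) • H u) u := by
      convert! H.hasFDerivAt_of_bilinear (hasFDerivAt_id u) (hasFDerivAt_id u) using 1
      ext v
      simp [hsymm v u, two_smul]
    convert! (((h1.sub_const (f x)).sub (f' x).hasFDerivAt).sub
      (h2.const_smul (1 / 2 : ℝ))).hasFDerivWithinAt using 1
    simp [smul_smul]
  -- The remainder has derivative o(‖u‖) because `f'` is differentiable at the single point x; the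
  -- mean value inequality on the ball of radius ‖y‖ then gives ε‖y‖².
  have hbound : ∀ u ∈ Metric.closedBall (0 : E) ‖y‖, ‖f' (x + u) - f' x - H u‖ ≤ ε * ‖y‖ :=
    fun u hu => (hball u (hsub hu)).2.trans (by
      have : ‖u‖ ≤ ‖y‖ := by simpa using hu
      gcongr)
  have := (convex_closedBall (0 : E) ‖y‖).norm_image_sub_le_of_norm_hasFDerivWithin_le hder hbound
    (Metric.mem_closedBall_self (norm_nonneg y)) (show y ∈ _ by simp)
  simpa [pow_two, mul_assoc] using this

/-- Wirtinger form of the quadratic term: the coefficients of y², |y|² and ȳ² are f_zz/2, f_zz̄ and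
f_z̄z̄/2. -/
lemma real_bilin_diag_eq (H : ℂ →L[ℝ] ℂ →L[ℝ] ℂ) (hsymm : H 1 Complex.I = H Complex.I 1) (y : ℂ) :
    (1 / 2 : ℝ) • H y y =
      (H 1 1 - H Complex.I Complex.I - 2 * Complex.I * H 1 Complex.I) / 8 * y ^ 2 +
      (H 1 1 + H Complex.I Complex.I) / 4 * (‖y‖ : ℂ) ^ 2 +
      (H 1 1 - H Complex.I Complex.I + 2 * Complex.I * H 1 Complex.I) / 8 * conj y ^ 2 := by
  have hy : y = y.re • (1 : ℂ) + y.im • Complex.I := by simp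
  have hH : H y y = y.re ^ 2 * H 1 1 + 2 * y.re * y.im * H 1 Complex.I
      + y.im ^ 2 * H Complex.I Complex.I := by
    conv_lhs => rw [hy]
    simp only [map_add, map_smul, add_apply, smul_apply, ← hsymm]
    simp only [Complex.real_smul]
    ring
  have hn : (‖y‖ : ℂ) ^ 2 = y.re ^ 2 + y.im ^ 2 := by
    rw [← Complex.ofReal_pow, ← Complex.normSq_eq_norm_sq, Complex.normSq_apply]
    push_cast; ring
  have hc : conj y = y.re - y.im * Complex.I := by apply Complex.ext <;> simp
  have hy' : y ^ 2 = (y.re + y.im * Complex.I) ^ 2 := by rw [Complex.re_add_im]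
  rw [hH, hn, hc, hy', Complex.real_smul]
  push_cast
  linear_combination (-(1/4) * (H 1 1 - H Complex.I Complex.I) * y.im ^ 2 +
    H 1 Complex.I * y.re * y.im) * Complex.I_sq

lemma exists_norm_one_mul_conj_sq (t : ℂ) : ∃ μ : ℂ, ‖μ‖ = 1 ∧ t = (‖t‖ : ℂ) * conj μ ^ 2 := by
  refine ⟨Complex.exp ((-(t.arg / 2) : ℝ) * Complex.I), Complex.norm_exp_ofReal_mul_I _, ?_⟩
  rw [← Complex.exp_conj, ← Complex.exp_nat_mul]
  conv_lhs => rw [← Complex.norm_mul_exp_arg_mul_I t]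
  congr 2
  simp only [map_mul, Complex.conj_ofReal, Complex.conj_I]
  push_cast
  ring

/-- Bishop's criterion: the graph of `f` has an elliptic complex tangent where `f_ξ̄ = 0` and
`|f_ξ̄ξ̄| < |f_ξξ̄|`. -/
lemma isEllipticPoint_graph {S : Set (ℂ × ℂ)} {f : ℂ → ℂ} {x₀ : ℂ} {f' : ℂ → ℂ →L[ℝ] ℂ}
    {H : ℂ →L[ℝ] ℂ →L[ℝ] ℂ} (hS : ∀ᶠ q in 𝓝 (x₀, f x₀), q ∈ S ↔ q.2 = f q.1)
    (hsm : ContDiffAt ℝ ∞ f x₀) (hf : ∀ᶠ y in 𝓝 x₀, HasFDerivAt f (f' y) y)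
    (hH : HasFDerivAt f' H x₀) (h0 : antiPart (f' x₀) 1 = 0)
    (hell : ‖H 1 1 - H Complex.I Complex.I + 2 * Complex.I * H 1 Complex.I‖ <
      ‖H 1 1 + H Complex.I Complex.I‖) : IsEllipticPoint S (x₀, f x₀) := by
  have hsymm := second_derivative_symmetric_of_eventually hf hH 1 Complex.I
  set α := (H 1 1 - H Complex.I Complex.I - 2 * Complex.I * H 1 Complex.I) / 8 with hα
  set β := (H 1 1 + H Complex.I Complex.I) / 4 with hβ
  set γ := (H 1 1 - H Complex.I Complex.I + 2 * Complex.I * H 1 Complex.I) / 8 with hγ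
  have hβ0 : β ≠ 0 := by
    intro h
    rw [hβ, div_eq_zero_iff] at h
    rcases h with h | h
    · rw [h, norm_zero] at hell
      exact absurd hell (not_lt.2 (norm_nonneg _))
    · norm_num at h
  have hβn : 0 < ‖β‖ := norm_pos_iff.2 hβ0
  -- The rotation x = μ(ξ - x₀) makes the coefficient of x̄², relative to that of |x|², the
  -- nonnegative number l = |γ/β|.
  obtain ⟨μ, hμ, hμt⟩ := exists_norm_one_mul_conj_sq (γ / β)
  have hμμ : conj μ * μ = 1 := by
    rw [mul_comm, Complex.mul_conj, Complex.normSq_eq_norm_sq, hμ]; simp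
  set l : ℝ := ‖γ / β‖ with hl
  have hl2 : l < 1 / 2 := by
    rw [hl, norm_div, div_lt_iff₀ hβn, hγ, hβ, norm_div, norm_div]
    norm_num
    linarith
  set d := f' x₀ 1 with hd
  have hlin : ∀ η, f' x₀ η = d * η := by
    intro η
    have h1 := (antiPart_eq_zero_iff _ _).1 h0
    rw [smul_eq_mul, mul_one] at h1
    conv_lhs => rw [show η = η.re • (1 : ℂ) + η.im • Complex.I by simp]
    rw [map_add, map_smul, map_smul, ← h1, ← hd]
    conv_rhs => rw [← Complex.re_add_im η]
    simp only [Complex.real_smul]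
    ring
  -- Subtract the holomorphic 2-jet, divide by the mixed coefficient β, rotate, and add l x² to
  -- match the term l x̄² that is already present.
  let Φ : ℂ × ℂ → ℂ × ℂ := fun q => (μ * (q.1 - x₀),
    (q.2 - f x₀ - d * (q.1 - x₀) - α * (q.1 - x₀) ^ 2) / β + l * μ ^ 2 * (q.1 - x₀) ^ 2)
  let h : ℂ → ℂ := fun x =>
    (f (x₀ + conj μ * x) - f x₀ - d * (conj μ * x) - α * (conj μ * x) ^ 2) / β + l * x ^ 2
  refine ⟨hS.self_of_nhds.2 rfl, Φ, h, l, ?_, ?_, ?_, ?_, norm_nonneg _, hl2, ?_, ?_⟩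
  · have h1 : AnalyticAt ℂ (fun q : ℂ × ℂ => q.1) (x₀, f x₀) := analyticAt_fst
    have h2 : AnalyticAt ℂ (fun q : ℂ × ℂ => q.2) (x₀, f x₀) := analyticAt_snd
    refine AnalyticAt.prod (by fun_prop) ?_
    simp only [div_eq_mul_inv]
    fun_prop
  · simp [Φ]
  · have hfst : HasFDerivAt (fun q : ℂ × ℂ => q.1 - x₀) (ContinuousLinearMap.fst ℂ ℂ ℂ)
        (x₀, f x₀) := hasFDerivAt_fst.sub_const x₀
    have hsnd : HasFDerivAt (fun q : ℂ × ℂ => q.2 - f x₀) (ContinuousLinearMap.snd ℂ ℂ ℂ)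
        (x₀, f x₀) := hasFDerivAt_snd.sub_const (f x₀)
    have hsq : HasFDerivAt (fun q : ℂ × ℂ => (q.1 - x₀) ^ 2) (0 : ℂ × ℂ →L[ℂ] ℂ) (x₀, f x₀) := by
      convert! hfst.pow 2 using 1
      ext <;> simp
    have hΦ : HasFDerivAt Φ ((μ • ContinuousLinearMap.fst ℂ ℂ ℂ).prod
        (β⁻¹ • (ContinuousLinearMap.snd ℂ ℂ ℂ - d • ContinuousLinearMap.fst ℂ ℂ ℂ))) (x₀, f x₀) := by
      refine (hfst.const_mul μ).prodMk ?_
      have := (((hsnd.sub (hfst.const_mul d)).sub (hsq.const_mul α)).mul_const β⁻¹).add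
        (hsq.const_mul ((l : ℂ) * μ ^ 2))
      convert! this using 1
      ext <;> simp
    rw [hΦ.fderiv]
    refine ContinuousLinearMap.IsInvertible.of_inverse
      (g := (conj μ • ContinuousLinearMap.fst ℂ ℂ ℂ).prod
        (β • ContinuousLinearMap.snd ℂ ℂ ℂ + (d * conj μ) • ContinuousLinearMap.fst ℂ ℂ ℂ)) ?_ ?_
    · refine ContinuousLinearMap.ext fun q => Prod.ext ?_ ?_
      · simp only [ContinuousLinearMap.comp_apply, ContinuousLinearMap.prod_apply, smul_apply,
          ContinuousLinearMap.coe_fst', smul_eq_mul, ContinuousLinearMap.id_apply]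
        linear_combination q.1 * hμμ
      · simp only [ContinuousLinearMap.comp_apply, ContinuousLinearMap.prod_apply, smul_apply,
          ContinuousLinearMap.coe_fst', smul_eq_mul, ContinuousLinearMap.id_apply,
          ContinuousLinearMap.coe_snd', sub_apply, add_apply]
        field_simp
        ring
    · refine ContinuousLinearMap.ext fun q => Prod.ext ?_ ?_
      · simp only [ContinuousLinearMap.comp_apply, ContinuousLinearMap.prod_apply, smul_apply,
          ContinuousLinearMap.coe_fst', smul_eq_mul, ContinuousLinearMap.id_apply]
        linear_combination q.1 * hμμ
      · simp only [ContinuousLinearMap.comp_apply, ContinuousLinearMap.prod_apply, smul_apply,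
          ContinuousLinearMap.coe_fst', smul_eq_mul, ContinuousLinearMap.id_apply,
          ContinuousLinearMap.coe_snd', sub_apply, add_apply]
        rw [mul_inv_cancel_left₀ hβ0]
        linear_combination d * q.1 * hμμ
  · have h1 : ContDiffAt ℝ ∞ (fun x : ℂ => f (x₀ + conj μ * x)) 0 :=
      ContDiffAt.comp (g := f) (0 : ℂ) (by simpa using hsm) (by fun_prop)
    simp only [h, div_eq_mul_inv]
    refine ContDiffAt.add (ContDiffAt.mul (((h1.sub contDiffAt_const).sub ?_).sub ?_)
      contDiffAt_const) ?_ <;> fun_prop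
  · have hT := isLittleO_taylor_two hf hH
    have htend : Tendsto (fun x : ℂ => conj μ * x) (𝓝 0) (𝓝 0) := by
      have : Continuous fun x : ℂ => conj μ * x := by fun_prop
      simpa using this.tendsto 0
    have hT' := hT.comp_tendsto htend
    have hnorm : ∀ x : ℂ, ‖conj μ * x‖ = ‖x‖ := fun x => by
      rw [norm_mul, RCLike.norm_conj, hμ, one_mul]
    have := hT'.const_mul_left β⁻¹
    refine (this.congr_right fun x => ?_).congr_left fun x => ?_
    · simp only [Function.comp_apply, hnorm]
    · simp only [Function.comp_apply, h, hlin, real_bilin_diag_eq H hsymm, ← hα, ← hβ, ← hγ, hnorm]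
      have hc : conj (conj μ * x) = μ * conj x := by simp
      rw [hc]
      have hγ' : γ = β * (l * conj μ ^ 2) := by
        rw [← hμt]; field_simp
      rw [hγ']
      field_simp
      linear_combination (-β * l * conj x ^ 2 * (conj μ * μ + 1)) * hμμ
  · filter_upwards [hS] with q hq
    rw [hq]
    simp only [Φ, h]
    have h1 : conj μ * (μ * (q.1 - x₀)) = q.1 - x₀ := by
      rw [← mul_assoc, hμμ, one_mul]
    rw [h1, show x₀ + (q.1 - x₀) = q.1 by ring, mul_pow, ← mul_assoc, add_left_inj,
      div_left_inj' hβ0, sub_left_inj, sub_left_inj, sub_left_inj]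

/-! ### The Levi form as an obstruction to holomorphic curves. -/

section HolomorphicCurves

variable {Z : Type*} [NormedAddCommGroup Z] [NormedSpace ℂ Z] [NormedSpace ℝ Z]
  [IsScalarTower ℝ ℂ Z]

/-- Four times the Levi form `∑ F_{z_j z̄_k} v_j v̄_k` of a function with second derivative `H`. -/
noncomputable def leviForm (H : Z →L[ℝ] Z →L[ℝ] ℂ) (v : Z) : ℂ :=
  H v v + H (Complex.I • v) (Complex.I • v)

lemma leviForm_smul {H : Z →L[ℝ] Z →L[ℝ] ℂ} (hH : ∀ u v, H u v = H v u) (s : ℂ) (v : Z) :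
    leviForm H (s • v) = (Complex.normSq s : ℂ) * leviForm H v := by
  have h1 : Complex.I • (s • v) = s.re • (Complex.I • v) + (-s.im) • v := by
    rw [smul_comm, smul_eq_re_smul_add_im_smul s, smul_smul, Complex.I_mul_I, neg_one_smul,
      smul_neg, neg_smul]
  rw [leviForm, leviForm, h1, smul_eq_re_smul_add_im_smul s v]
  simp only [map_add, map_smul, add_apply, smul_apply]
  rw [hH (Complex.I • v) v, Complex.normSq_apply]
  simp only [Complex.real_smul]
  push_cast
  ring

/-- Differentiating w = F ∘ z as a real map gives D(ηv) = ηb for all complex η, so D is complex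
linear on ℂv. -/
lemma antiPart_deriv_eq_zero {F : Z → ℂ} {D : Z →L[ℝ] ℂ} {z : ℂ → Z} {w : ℂ → ℂ} {ζ : ℂ}
    {v : Z} {b : ℂ} (hF : HasFDerivAt F D (z ζ)) (hz : HasDerivAt z v ζ) (hw : HasDerivAt w b ζ)
    (h : ∀ᶠ ζ' in 𝓝 ζ, w ζ' = F (z ζ')) : D v = b ∧ antiPart D v = 0 := by
  have h1 : HasFDerivAt w _ ζ := (hF.comp ζ (hz.hasFDerivAt.restrictScalars ℝ)).congr_of_eventuallyEq h
  have h2 := h1.unique (hw.hasFDerivAt.restrictScalars ℝ)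
  have h3 : ∀ η : ℂ, D (η • v) = η * b := fun η => by
    simpa using DFunLike.congr_fun h2 η
  have h4 : D v = b := by simpa using h3 1
  exact ⟨h4, (antiPart_eq_zero_iff D v).2 (by rw [h3, h4])⟩

/-- Differentiate the tangency relation in the directions 1 and i. In (first) - i (second) the terms
with z'' cancel, and so do the mixed terms by symmetry of H; the Levi form remains. -/
lemma leviForm_deriv_eq_zero {F' : Z → Z →L[ℝ] ℂ} {H : Z →L[ℝ] Z →L[ℝ] ℂ} {z z' : ℂ → Z} {ζ : ℂ}
    {b : Z} (hF : HasFDerivAt F' H (z ζ)) (hz : HasDerivAt z (z' ζ) ζ) (hz' : HasDerivAt z' b ζ)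
    (hH : ∀ u v, H u v = H v u)
    (h : ∀ᶠ ζ' in 𝓝 ζ, antiPart (F' (z ζ')) (z' ζ') = 0) : leviForm H (z' ζ) = 0 := by
  have hc := hF.comp ζ (hz.hasFDerivAt.restrictScalars ℝ)
  have h1 := hc.clm_apply (hz'.hasFDerivAt.restrictScalars ℝ)
  have h2 := hc.clm_apply ((hz'.const_smul Complex.I).hasFDerivAt.restrictScalars ℝ)
  have h3 : HasFDerivAt (fun ζ' => antiPart (F' (z ζ')) (z' ζ')) _ ζ := h1.add (h2.const_mul Complex.I)
  have h4 := h3.unique ((hasFDerivAt_const (0 : ℂ) ζ).congr_of_eventuallyEq h)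
  have e1 := DFunLike.congr_fun h4 1
  have e2 := DFunLike.congr_fun h4 Complex.I
  simp only [add_apply, smul_apply, ContinuousLinearMap.comp_apply, zero_apply, smul_eq_mul,
    ContinuousLinearMap.flip_apply, ContinuousLinearMap.coe_restrictScalars',
    ContinuousLinearMap.toSpanSingleton_apply, one_smul, Function.comp_apply, smul_smul,
    Complex.I_mul_I, neg_smul, map_neg, one_mul, Pi.smul_apply] at e1 e2
  rw [leviForm]
  rw [hH (Complex.I • z' ζ) (z' ζ)] at e2
  linear_combination e1 - Complex.I * e2 + (H (Complex.I • z' ζ) (Complex.I • z' ζ) - F' (z ζ) b) *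
    Complex.I_sq

lemma eventually_leviForm_ne_zero {F' : Z → Z →L[ℝ] ℂ} {H : Z → Z →L[ℝ] Z →L[ℝ] ℂ} {z₀ c a : Z}
    (hF : ContinuousAt F' z₀) (hH : ContinuousAt H z₀)
    (hsymm : ∀ᶠ z in 𝓝 z₀, ∀ u v, H z u v = H z v u)
    (hspan : ∀ v : Z, ∃ x y : ℂ, v = x • c + y • a) (hc : antiPart (F' z₀) c = 0)
    (ha : antiPart (F' z₀) a ≠ 0) (hlevi : leviForm (H z₀) c ≠ 0) :
    ∀ᶠ z in 𝓝 z₀, ∀ v ≠ 0, antiPart (F' z) v = 0 → leviForm (H z) v ≠ 0 := by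
  have hcont : ∀ v, ContinuousAt (fun z => antiPart (F' z) v) z₀ := fun v => by
    unfold antiPart
    exact (hF.clm_apply continuousAt_const).add
      (continuousAt_const.mul (hF.clm_apply continuousAt_const))
  -- `k z` lies in the kernel of `antiPart (F' z)`, spans it when `antiPart (F' z) a` is nonzero,
  -- and depends continuously on z; at z₀ it is a nonzero multiple of c.
  let k : Z → Z := fun z => conj (antiPart (F' z) a) • c - conj (antiPart (F' z) c) • a
  have hk : ContinuousAt k z₀ :=
    ((Complex.continuous_conj.continuousAt.comp (hcont a)).smul continuousAt_const).sub
      ((Complex.continuous_conj.continuousAt.comp (hcont c)).smul continuousAt_const)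
  have hL : ContinuousAt (fun z => leviForm (H z) (k z)) z₀ :=
    ((hH.clm_apply hk).clm_apply hk).add
      ((hH.clm_apply (hk.const_smul Complex.I)).clm_apply (hk.const_smul Complex.I))
  have hk0 : leviForm (H z₀) (k z₀) ≠ 0 := by
    have : k z₀ = conj (antiPart (F' z₀) a) • c := by simp [k, hc]
    rw [this, leviForm_smul hsymm.self_of_nhds]
    exact mul_ne_zero (by simpa using ha) hlevi
  filter_upwards [hsymm, (hcont a).eventually_ne ha, hL.eventually_ne hk0] with z hs hAz hLz v hv h0
  obtain ⟨x, y, rfl⟩ := hspan v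
  have hA' : conj (antiPart (F' z) a) ≠ 0 := by simpa using hAz
  have hrel : x * conj (antiPart (F' z) c) + y * conj (antiPart (F' z) a) = 0 := by
    rw [antiPart_add, antiPart_smul, antiPart_smul] at h0
    simpa using congrArg conj h0
  have hvk : x • c + y • a = (x / conj (antiPart (F' z) a)) • k z := by
    simp only [k, smul_sub, smul_smul, div_mul_cancel₀ _ hA']
    rw [sub_eq_add_neg, ← neg_smul]
    congr 2
    field_simp
    linear_combination hrel
  rw [hvk] at hv ⊢
  rw [leviForm_smul hs]
  refine mul_ne_zero ?_ hLz
  have := left_ne_zero_of_smul hv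
  simpa [-map_div₀, -div_eq_zero_iff] using this

lemma AnalyticAt.frequently_deriv_ne_zero {X : Type*} [NormedAddCommGroup X] [NormedSpace ℂ X]
    [CompleteSpace X] {γ : ℂ → X} {x : ℂ} (hγ : AnalyticAt ℂ γ x)
    (h : ¬ ∀ᶠ ζ in 𝓝 x, γ ζ = γ x) : ∃ᶠ ζ in 𝓝 x, deriv γ ζ ≠ 0 := by
  intro hcon
  apply h
  obtain ⟨r, hr, hball⟩ := Metric.eventually_nhds_iff_ball.1 (hγ.eventually_analyticAt.and hcon)
  filter_upwards [Metric.ball_mem_nhds x hr] with ζ hζ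
  refine Metric.isOpen_ball.is_const_of_deriv_eq_zero (convex_ball x r).isPreconnected
    (fun y hy => (hball y hy).1.differentiableAt.differentiableWithinAt)
    (fun y hy => ?_) hζ (Metric.mem_ball_self hr)
  simpa using (hball y hy).2

/-- No holomorphic curve passes through a point of the graph of `F` at which `∂̄F ≠ 0` and the Levi
form does not vanish on the holomorphic tangent space `ℂ c`. -/
lemma not_hasHolomorphicCurveThrough_graph [CompleteSpace Z] {S : Set (Z × ℂ)} {F : Z → ℂ}
    {F' : Z → Z →L[ℝ] ℂ} {H : Z → Z →L[ℝ] Z →L[ℝ] ℂ} {z₀ c a : Z}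
    (hS : ∀ᶠ q in 𝓝 (z₀, F z₀), q ∈ S ↔ q.2 = F q.1)
    (hF : ∀ᶠ z in 𝓝 z₀, HasFDerivAt F (F' z) z) (hF' : ∀ᶠ z in 𝓝 z₀, HasFDerivAt F' (H z) z)
    (hH : ContinuousAt H z₀)
    (hspan : ∀ v : Z, ∃ x y : ℂ, v = x • c + y • a) (hc : antiPart (F' z₀) c = 0)
    (ha : antiPart (F' z₀) a ≠ 0) (hlevi : leviForm (H z₀) c ≠ 0) :
    ¬ HasHolomorphicCurveThrough S (z₀, F z₀) := by
  rintro ⟨γ, hγ, hγ0, hγS, hne⟩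
  have hsymm : ∀ᶠ z in 𝓝 z₀, ∀ u v, H z u v = H z v u := by
    filter_upwards [hF.eventually_nhds, hF'] with z h1 h2 u v
    exact second_derivative_symmetric_of_eventually h1 h2 u v
  have hL := eventually_leviForm_ne_zero hF'.self_of_nhds.continuousAt hH hsymm hspan hc ha hlevi
  have hγt : Tendsto γ (𝓝 0) (𝓝 (z₀, F z₀)) := by simpa [hγ0] using hγ.continuousAt.tendsto
  have hzt : Tendsto (fun ζ => (γ ζ).1) (𝓝 0) (𝓝 z₀) :=
    (continuous_fst.tendsto (z₀, F z₀)).comp hγt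
  rw [← hγ0] at hne
  have hgraph : ∀ᶠ ζ in 𝓝 0, (γ ζ).2 = F (γ ζ).1 := by
    filter_upwards [hγS, hγt.eventually hS] with ζ h1 h2
    exact h2.1 h1
  have hdz : ∀ ζ, AnalyticAt ℂ γ ζ → HasDerivAt (fun ζ => (γ ζ).1) (deriv γ ζ).1 ζ := fun ζ h =>
    h.differentiableAt.hasDerivAt.fst
  have hdw : ∀ ζ, AnalyticAt ℂ γ ζ → HasDerivAt (fun ζ => (γ ζ).2) (deriv γ ζ).2 ζ := fun ζ h =>
    h.differentiableAt.hasDerivAt.snd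
  have htan : ∀ᶠ ζ in 𝓝 0, F' (γ ζ).1 (deriv γ ζ).1 = (deriv γ ζ).2 ∧
      antiPart (F' (γ ζ).1) (deriv γ ζ).1 = 0 := by
    filter_upwards [hγ.eventually_analyticAt, hgraph.eventually_nhds, hzt.eventually hF]
      with ζ h1 h2 h3
    exact antiPart_deriv_eq_zero h3 (hdz ζ h1) (hdw ζ h1) h2
  -- The curve may be singular at 0, so the contradiction is sought at a nearby parameter where its
  -- velocity is nonzero.
  obtain ⟨ζ, hζ, h1, h2, h3, h4, h5⟩ := ((hγ.frequently_deriv_ne_zero hne).and_eventually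
    (hγ.eventually_analyticAt.and (htan.eventually_nhds.and ((hzt.eventually hL).and
      ((hzt.eventually hF').and (hzt.eventually hsymm)))))).exists
  have h2' := h2.self_of_nhds
  -- The z-component of the velocity cannot vanish: the w-component is its image under dF.
  refine h3 (deriv γ ζ).1 (fun h => hζ (Prod.ext h ?_)) h2'.2 ?_
  · rw [← h2'.1, h, map_zero]; rfl
  · exact leviForm_deriv_eq_zero h4 (hdz ζ h1)
      (h1.deriv.differentiableAt.hasDerivAt.fst) h5 (h2.mono fun _ h => h.2)

end HolomorphicCurves

/-! ### A term of order |z|³ does not change the 2-jet. -/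

section SecondOrderVanishing

variable {E G : Type*} [NormedAddCommGroup E] [NormedSpace ℝ E] [NormedAddCommGroup G]
  [NormedSpace ℝ G]

/-- The diagonal is homogeneous of degree two, so being o(‖y‖²) forces it to vanish along each ray;
polarization does the rest. -/
lemma bilin_eq_zero_of_diag_isLittleO {k : E →L[ℝ] E →L[ℝ] G} (hsymm : ∀ u v, k u v = k v u)
    (h : (fun y => k y y) =o[𝓝 0] fun y => ‖y‖ ^ 2) : k = 0 := by
  have hdiag : ∀ y, k y y = 0 := by
    intro y
    have ht : Tendsto (fun t : ℝ => t • y) (𝓝[≠] 0) (𝓝 0) := by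
      have : Continuous fun t : ℝ => t • y := by fun_prop
      have := this.tendsto 0
      rw [zero_smul] at this
      exact this.mono_left nhdsWithin_le_nhds
    have h1 : (fun _ : ℝ => k y y) =o[𝓝[≠] 0] fun _ : ℝ => ‖y‖ ^ 2 := by
      rw [isLittleO_iff]
      intro ε hε
      filter_upwards [(isLittleO_iff.1 (h.comp_tendsto ht)) hε, self_mem_nhdsWithin] with t h2 h3
      have ht2 : 0 < t ^ 2 := by have : t ≠ 0 := h3; positivity
      have e1 : ‖k (t • y) (t • y)‖ = t ^ 2 * ‖k y y‖ := by
        rw [map_smul, map_smul, smul_apply, smul_smul, ← pow_two, norm_smul, Real.norm_of_nonneg ht2.le]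
      have e2 : ‖‖t • y‖ ^ 2‖ = t ^ 2 * ‖‖y‖ ^ 2‖ := by
        rw [norm_smul, mul_pow, norm_mul, Real.norm_eq_abs t, sq_abs, Real.norm_of_nonneg ht2.le]
      simp only [Function.comp_apply, e1, e2] at h2
      exact le_of_mul_le_mul_left (by linarith) ht2
    rw [isLittleO_const_left] at h1
    rcases h1 with h1 | h1
    · exact h1
    · have h2 : ¬ Tendsto (norm ∘ fun _ : ℝ => ‖y‖ ^ 2) (𝓝[≠] 0) atTop :=
        not_tendsto_atTop_of_tendsto_nhds tendsto_const_nhds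
      exact absurd h1 h2
  refine ContinuousLinearMap.ext fun u => ContinuousLinearMap.ext fun v => ?_
  have h1 := hdiag (u + v)
  simp only [map_add, add_apply, hdiag, hsymm v u, zero_add, add_zero] at h1
  rw [← two_smul ℝ] at h1
  simpa using h1

lemma AnalyticAt.second_order_vanishing [CompleteSpace G] {f : E → G} (hf : AnalyticAt ℝ f 0)
    (h : f =O[𝓝 0] fun z => ‖z‖ ^ 3) :
    f 0 = 0 ∧ fderiv ℝ f 0 = 0 ∧ HasFDerivAt (fderiv ℝ f) (0 : E →L[ℝ] E →L[ℝ] G) 0 := by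
  have h0 : f 0 = 0 := by
    obtain ⟨C, hC⟩ := h.bound
    simpa using hC.self_of_nhds
  have hpow : ∀ n < 3, (fun z : E => ‖z‖ ^ 3) =o[𝓝 0] fun z => ‖z‖ ^ n := fun n hn =>
    (isLittleO_pow_pow hn).comp_tendsto tendsto_norm_zero
  have h1 : HasFDerivAt f (0 : E →L[ℝ] G) 0 := by
    rw [hasFDerivAt_iff_isLittleO_nhds_zero]
    refine (((h.trans_isLittleO (hpow 1 (by norm_num))).congr_right fun z =>
      pow_one ‖z‖).of_norm_right).congr_left fun z => ?_
    simp [h0]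
  have hd : ∀ᶠ y in 𝓝 (0 : E), HasFDerivAt f (fderiv ℝ f y) y :=
    hf.eventually_analyticAt.mono fun y hy => hy.differentiableAt.hasFDerivAt
  have h2 := hf.fderiv.differentiableAt.hasFDerivAt
  have hT := isLittleO_taylor_two hd h2
  have hk : fderiv ℝ (fderiv ℝ f) 0 = 0 := by
    apply bilin_eq_zero_of_diag_isLittleO
      (fun u v => second_derivative_symmetric_of_eventually hd h2 u v)
    have := (((h.trans_isLittleO (hpow 2 (by norm_num))).sub hT).const_smul_left (2 : ℝ) :)
    refine this.congr_left fun y => ?_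
    simp [h0, h1.fderiv, smul_smul]
  exact ⟨h0, h1.fderiv, hk ▸ h2⟩

end SecondOrderVanishing

/-! ### Derivatives of the quadratic model. -/

section QuadraticPart

lemma dotProduct_two (u v : Fin 2 → ℂ) : u ⬝ᵥ v = u 0 * v 0 + u 1 * v 1 := by
  simp [dotProduct, Fin.sum_univ_two]

/-- The real bilinear form whose restriction to the diagonal is `2 * quadForm A B`. -/
noncomputable def polarForm (A B : Matrix (Fin 2) (Fin 2) ℂ) :
    (Fin 2 → ℂ) →L[ℝ] (Fin 2 → ℂ) →L[ℝ] ℂ :=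
  LinearMap.toContinuousBilinearMap <| LinearMap.mk₂ ℝ
    (fun u v => 2 * (((u ⬝ᵥ (A *ᵥ v)).re : ℝ) : ℂ) + 2 * (((v ⬝ᵥ (A *ᵥ u)).re : ℝ) : ℂ) +
      u ⬝ᵥ (B *ᵥ star v) + v ⬝ᵥ (B *ᵥ star u))
    (fun u u' v => by
      simp only [add_dotProduct, dotProduct_add, Matrix.mulVec_add, star_add, Complex.add_re]
      push_cast; ring)
    (fun t u v => by
      simp only [smul_dotProduct, dotProduct_smul, Matrix.mulVec_smul, star_smul, star_trivial,
        Complex.real_smul, Complex.re_ofReal_mul]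
      push_cast; ring)
    (fun u v v' => by
      simp only [add_dotProduct, dotProduct_add, Matrix.mulVec_add, star_add, Complex.add_re]
      push_cast; ring)
    (fun t u v => by
      simp only [smul_dotProduct, dotProduct_smul, Matrix.mulVec_smul, star_smul, star_trivial,
        Complex.real_smul, Complex.re_ofReal_mul]
      push_cast; ring)

variable (A B : Matrix (Fin 2) (Fin 2) ℂ)

lemma polarForm_apply (u v : Fin 2 → ℂ) : polarForm A B u v =
    2 * (((u ⬝ᵥ (A *ᵥ v)).re : ℝ) : ℂ) + 2 * (((v ⬝ᵥ (A *ᵥ u)).re : ℝ) : ℂ) +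
      u ⬝ᵥ (B *ᵥ star v) + v ⬝ᵥ (B *ᵥ star u) := rfl

/-- The derivative is linear in z, so `polarForm A B` is also the second derivative of the model. -/
lemma hasFDerivAt_quadForm (z : Fin 2 → ℂ) :
    HasFDerivAt (quadForm A B) (polarForm A B z) z := by
  have h1 : quadForm A B = fun z => (1 / 2 : ℝ) • polarForm A B z z := by
    funext z
    rw [polarForm_apply, quadForm, Complex.real_smul]
    push_cast; ring
  have h2 := ((polarForm A B).hasFDerivAt_of_bilinear (hasFDerivAt_id z)
    (hasFDerivAt_id z)).const_smul (1 / 2 : ℝ)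
  rw [h1]
  convert! h2 using 1
  ext v
  have : polarForm A B v z = polarForm A B z v := by
    rw [polarForm_apply, polarForm_apply]; ring
  simp [this, ← two_mul]

lemma analyticAt_quadForm (z : Fin 2 → ℂ) : AnalyticAt ℝ (quadForm A B) z := by
  have h1 : quadForm A B = fun z => (1 / 2 : ℝ) • polarForm A B z z := by
    funext z
    rw [polarForm_apply, quadForm, Complex.real_smul]
    push_cast; ring
  rw [h1]
  apply ContDiffAt.analyticAt
  exact ContDiffAt.const_smul (1 / 2 : ℝ)
    ((polarForm A B).contDiff.contDiffAt.clm_apply contDiffAt_id)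

/-- The part 2 Re(zAzᵗ) is pluriharmonic, so only B contributes. -/
lemma polarForm_levi (c : Fin 2 → ℂ) :
    polarForm A B c c + polarForm A B (Complex.I • c) (Complex.I • c) =
      4 * (c ⬝ᵥ (B *ᵥ star c)) := by
  simp only [polarForm_apply, smul_dotProduct, dotProduct_smul, Matrix.mulVec_smul, star_smul,
    smul_eq_mul, Complex.star_def, Complex.conj_I, ← mul_assoc, Complex.I_mul_I]
  simp only [neg_mul, mul_neg, Complex.I_mul_I, Complex.neg_re, one_mul, Complex.ofReal_neg, neg_neg]
  ring

/-- Only the antiholomorphic half of 2 Re(zAzᵗ) survives. Against the factor 4 of `polarForm_levi`,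
the factor 8 turns Bishop's inequality into 2|cAcᵗ| < |cBc̄ᵗ|. -/
lemma polarForm_antiHessian (c : Fin 2 → ℂ) :
    polarForm A B c c - polarForm A B (Complex.I • c) (Complex.I • c) +
      2 * Complex.I * polarForm A B c (Complex.I • c) = 8 * conj (c ⬝ᵥ (A *ᵥ c)) := by
  simp only [polarForm_apply, smul_dotProduct, dotProduct_smul, Matrix.mulVec_smul, star_smul,
    smul_eq_mul, Complex.star_def, Complex.conj_I, ← mul_assoc, Complex.I_mul_I]
  simp only [neg_mul, mul_neg, Complex.I_mul_I, Complex.neg_re, one_mul, Complex.ofReal_neg, neg_neg,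
    Complex.I_mul_re]
  set s := c ⬝ᵥ (A *ᵥ c)
  have hc : conj s = s.re - s.im * Complex.I := by apply Complex.ext <;> simp
  rw [hc]
  ring

lemma antiPart_polarForm (u v : Fin 2 → ℂ) : antiPart (polarForm A B u) v =
    2 * conj (u ⬝ᵥ (A *ᵥ v)) + 2 * conj (v ⬝ᵥ (A *ᵥ u)) + 2 * (u ⬝ᵥ (B *ᵥ star v)) := by
  rw [antiPart]
  simp only [polarForm_apply, smul_dotProduct, dotProduct_smul, Matrix.mulVec_smul, star_smul,
    smul_eq_mul, Complex.star_def, Complex.conj_I, Complex.I_mul_re, neg_mul]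
  have hc : ∀ s : ℂ, conj s = s.re - s.im * Complex.I := fun s => by apply Complex.ext <;> simp
  rw [hc, hc]
  push_cast
  linear_combination (v ⬝ᵥ (B *ᵥ star u) - u ⬝ᵥ (B *ᵥ star v)) * Complex.I_sq

end QuadraticPart

/-! ### Case analysis of the normal forms. -/

section NormalForms

lemma dotProduct_mulVec_two (A : Matrix (Fin 2) (Fin 2) ℂ) (u v : Fin 2 → ℂ) : u ⬝ᵥ (A *ᵥ v) =
    u 0 * (A 0 0 * v 0 + A 0 1 * v 1) + u 1 * (A 1 0 * v 0 + A 1 1 * v 1) := by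
  rw [dotProduct_two]
  simp only [Matrix.mulVec, dotProduct_two]

/-- Where possible c is a zero of cAcᵗ with cBc̄ᵗ ≠ 0; for diagonal A the vector (√l₂, i√l₁) is such
a zero. -/
lemma IsCoffmanForm.exists_direction {A B : Matrix (Fin 2) (Fin 2) ℂ} (h : IsCoffmanForm A B) :
    ∃ c : Fin 2 → ℂ, 2 * ‖c ⬝ᵥ (A *ᵥ c)‖ < ‖c ⬝ᵥ (B *ᵥ star c)‖ := by
  suffices ∃ x y : ℂ, 2 * ‖x * (A 0 0 * x + A 0 1 * y) + y * (A 1 0 * x + A 1 1 * y)‖ <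
      ‖x * (B 0 0 * conj x + B 0 1 * conj y) + y * (B 1 0 * conj x + B 1 1 * conj y)‖ by
    obtain ⟨x, y, hxy⟩ := this
    refine ⟨![x, y], ?_⟩
    rw [dotProduct_mulVec_two, dotProduct_mulVec_two]
    exact hxy
  rcases h with ⟨rfl, l₁, l₂, rfl, h1, h2, h3⟩ | ⟨rfl, l₁, l₂, rfl, h1, h2, h3⟩ |
    ⟨rfl, l, rfl, hl⟩ | ⟨rfl, rfl⟩ | ⟨rfl, b, rfl, hb⟩ | ⟨rfl, d, rfl, hd⟩
  · by_cases h0 : l₁ = 0 ∧ l₂ = 0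
    · exact ⟨1, 0, by simp [h0.1]⟩
    · refine ⟨(√l₂ : ℂ), Complex.I * (√l₁ : ℂ), ?_⟩
      have e1 : (√l₁ : ℂ) ^ 2 = l₁ := by rw [← Complex.ofReal_pow, Real.sq_sqrt h1]
      have e2 : (√l₂ : ℂ) ^ 2 = l₂ := by rw [← Complex.ofReal_pow, Real.sq_sqrt h2]
      have hA : (√l₂ : ℂ) * (l₁ * (√l₂ : ℂ)) +
          Complex.I * (√l₁ : ℂ) * (l₂ * (Complex.I * (√l₁ : ℂ))) = 0 := by
        linear_combination (l₁ : ℂ) * e2 + (l₂ : ℂ) * Complex.I ^ 2 * e1 + (l₁ * l₂ : ℂ) * Complex.I_sq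
      have hB : (√l₂ : ℂ) * (√l₂ : ℂ) + -(Complex.I * (√l₁ : ℂ) * (Complex.I * (√l₁ : ℂ))) =
          ((l₁ + l₂ : ℝ) : ℂ) := by
        push_cast
        linear_combination e2 - Complex.I ^ 2 * e1 - (l₁ : ℂ) * Complex.I_sq
      have hpos : l₁ + l₂ ≠ 0 := fun h => h0 ⟨by linarith, by linarith⟩
      simp [hA, hB, -Complex.ofReal_add, hpos]
  · by_cases h0 : l₁ < 1 / 2
    · refine ⟨1, 0, ?_⟩
      simp [abs_of_nonneg h1]
      linarith
    · have h3' : l₁ < l₂ := (h3.resolve_left h0).2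
      have h2' : 0 ≤ l₂ := h1.trans h2
      refine ⟨(√l₂ : ℂ), Complex.I * (√l₁ : ℂ), ?_⟩
      have e1 : (√l₁ : ℂ) ^ 2 = l₁ := by rw [← Complex.ofReal_pow, Real.sq_sqrt h1]
      have e2 : (√l₂ : ℂ) ^ 2 = l₂ := by rw [← Complex.ofReal_pow, Real.sq_sqrt h2']
      have hA : (√l₂ : ℂ) * (l₁ * (√l₂ : ℂ)) +
          Complex.I * (√l₁ : ℂ) * (l₂ * (Complex.I * (√l₁ : ℂ))) = 0 := by
        linear_combination (l₁ : ℂ) * e2 + (l₂ : ℂ) * Complex.I ^ 2 * e1 + (l₁ * l₂ : ℂ) * Complex.I_sq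
      have hB : (√l₂ : ℂ) * (√l₂ : ℂ) + Complex.I * (√l₁ : ℂ) * (Complex.I * (√l₁ : ℂ)) =
          ((l₂ - l₁ : ℝ) : ℂ) := by
        push_cast
        linear_combination e2 + Complex.I ^ 2 * e1 + (l₁ : ℂ) * Complex.I_sq
      have hpos : l₂ - l₁ ≠ 0 := by linarith
      simp [hA, hB, -Complex.ofReal_sub, hpos]
  · exact ⟨1, 0, by simp⟩
  · refine ⟨1, -(1 / 2), ?_⟩
    simp [map_ofNat]
    norm_num
  · refine ⟨(-(1 / (4 * b)) : ℝ), 1, ?_⟩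
    have hb' : (b : ℂ) ≠ 0 := by exact_mod_cast hb.ne'
    have hA : ((-(1 / (4 * b)) : ℝ) : ℂ) * b + (b * ((-(1 / (4 * b)) : ℝ) : ℂ) + 1 / 2) = 0 := by
      push_cast
      field_simp
      ring
    have hB : ((-(1 / (4 * b)) : ℝ) : ℂ) + ((-(1 / (4 * b)) : ℝ) : ℂ) ≠ 0 := by
      rw [← Complex.ofReal_add, Complex.ofReal_ne_zero]
      have : 0 < 1 / (4 * b) := by positivity
      linarith
    simp only [Matrix.cons_val_zero, Matrix.cons_val_one, Matrix.of_apply, Complex.conj_ofReal,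
      Matrix.cons_val', zero_mul, one_mul, mul_one, zero_add, add_zero, map_one, hA, norm_zero,
      mul_zero, Matrix.cons_val_fin_one]
    exact norm_pos_iff.2 hB
  · obtain ⟨x, hx⟩ := IsAlgClosed.exists_pow_nat_eq (-2 * d) (n := 2) (by norm_num)
    refine ⟨x, 1, ?_⟩
    have hA : x * (1 / 2 * x) + d = 0 := by linear_combination (1 / 2) * hx
    have hB : x + conj x ≠ 0 := by
      intro h
      rw [Complex.add_conj, Complex.ofReal_eq_zero] at h
      have := congrArg Complex.im hx
      simp [pow_two] at this
      have hre : x.re = 0 := by linarith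
      rw [hre] at this
      linarith
    simp only [Matrix.cons_val_zero, Matrix.cons_val_one, Matrix.of_apply,
      Matrix.cons_val', zero_mul, one_mul, mul_one, zero_add, add_zero, map_one, hA, norm_zero,
      mul_zero, Matrix.cons_val_fin_one]
    exact norm_pos_iff.2 hB

/-- The real kernel of `u ↦ ∂̄(quadForm A B)(u)` has dimension at most one. -/
lemma IsCoffmanForm.exists_functional {A B : Matrix (Fin 2) (Fin 2) ℂ} (h : IsCoffmanForm A B) :
    ∃ φ : (Fin 2 → ℂ) →ₗ[ℝ] ℝ, ∀ u, (∀ v, antiPart (polarForm A B u) v = 0) → φ u = 0 → u = 0 := by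
  have hev : ∀ u : Fin 2 → ℂ, (∀ v, antiPart (polarForm A B u) v = 0) →
      conj (u 0 * A 0 0 + u 1 * A 1 0) + conj (A 0 0 * u 0 + A 0 1 * u 1) +
        (u 0 * B 0 0 + u 1 * B 1 0) = 0 ∧
      conj (u 0 * A 0 1 + u 1 * A 1 1) + conj (A 1 0 * u 0 + A 1 1 * u 1) +
        (u 0 * B 0 1 + u 1 * B 1 1) = 0 := by
    intro u hu
    constructor
    · have := hu ![1, 0]
      rw [antiPart_polarForm, dotProduct_mulVec_two, dotProduct_mulVec_two,
        dotProduct_mulVec_two] at this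
      simp only [Matrix.cons_val_zero, Matrix.cons_val_one, Pi.star_apply, star_one, star_zero,
        mul_one, mul_zero, add_zero, zero_mul, one_mul, Matrix.cons_val_fin_one] at this
      linear_combination (1 / 2) * this
    · have := hu ![0, 1]
      rw [antiPart_polarForm, dotProduct_mulVec_two, dotProduct_mulVec_two,
        dotProduct_mulVec_two] at this
      simp only [Matrix.cons_val_zero, Matrix.cons_val_one, Pi.star_apply, star_one, star_zero,
        mul_one, mul_zero, zero_add, zero_mul, one_mul, Matrix.cons_val_fin_one] at this
      linear_combination (1 / 2) * this
  let re (i : Fin 2) : (Fin 2 → ℂ) →ₗ[ℝ] ℝ := Complex.reLm ∘ₗ LinearMap.proj i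
  let im (i : Fin 2) : (Fin 2 → ℂ) →ₗ[ℝ] ℝ := Complex.imLm ∘ₗ LinearMap.proj i
  have hzero : ∀ u : Fin 2 → ℂ, (u 0).re = 0 → (u 0).im = 0 → (u 1).re = 0 → (u 1).im = 0 →
      u = 0 := by
    intro u h1 h2 h3 h4
    funext i
    fin_cases i
    · exact Complex.ext h1 h2
    · exact Complex.ext h3 h4
  have hcancel : ∀ s t : ℝ, s ≠ 0 → s * t = 0 → t = 0 := fun s t hs h =>
    (mul_eq_zero.1 h).resolve_left hs
  have hparts : ∀ u : Fin 2 → ℂ, (∀ v, antiPart (polarForm A B u) v = 0) → _ ∧ _ ∧ _ ∧ _ :=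
    fun u hu => ⟨congrArg Complex.re (hev u hu).1, congrArg Complex.im (hev u hu).1,
      congrArg Complex.re (hev u hu).2, congrArg Complex.im (hev u hu).2⟩
  rcases h with ⟨rfl, l₁, l₂, rfl, h1, h2, h3⟩ | ⟨rfl, l₁, l₂, rfl, h1, h2, h3⟩ |
    ⟨rfl, l, rfl, hl⟩ | ⟨rfl, rfl⟩ | ⟨rfl, b, rfl, hb⟩ | ⟨rfl, d, rfl, hd⟩
  -- The equations decouple into (1 + 2lⱼ) Re uⱼ = 0 and (1 - 2lⱼ) Im uⱼ = 0. Only a coordinate with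
  -- lⱼ = 1/2 leaves freedom, and φ reads off its imaginary part.
  · rcases h3 with h3 | h3
    · refine ⟨im 1, fun u hu (hφ : (u 1).im = 0) => ?_⟩
      obtain ⟨r1, i1, r2, i2⟩ := hparts u hu
      simp at r1 i1 r2 i2
      exact hzero u (hcancel (1 + 2 * l₁) _ (by linarith) (by linarith))
        (hcancel (1 - 2 * l₁) _ (by intro h; apply h3; linarith) (by linarith))
        (hcancel (1 + 2 * l₂) _ (by linarith) (by linarith)) hφ
    · refine ⟨im 0, fun u hu (hφ : (u 0).im = 0) => ?_⟩
      obtain ⟨r1, i1, r2, i2⟩ := hparts u hu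
      simp at r1 i1 r2 i2
      exact hzero u (hcancel (1 + 2 * l₁) _ (by linarith) (by linarith)) hφ
        (hcancel (1 + 2 * l₂) _ (by linarith) (by linarith))
        (hcancel (1 - 2 * l₂) _ (by intro h; apply h3; linarith) (by linarith))
  -- The sign in B exchanges the roles of real and imaginary part for u₁: the free coordinate is Re
  -- u₁ if l₂ = 1/2 and Im u₀ if l₁ = 1/2. The hypotheses exclude both at once.
  · rcases h3 with h3 | ⟨h3, h4⟩
    · refine ⟨re 1, fun u hu (hφ : (u 1).re = 0) => ?_⟩
      obtain ⟨r1, i1, r2, i2⟩ := hparts u hu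
      simp at r1 i1 r2 i2
      exact hzero u (hcancel (1 + 2 * l₁) _ (by linarith) (by linarith))
        (hcancel (1 - 2 * l₁) _ (by linarith) (by linarith)) hφ
        (hcancel (1 + 2 * l₂) _ (by linarith) (by linarith))
    · refine ⟨im 0, fun u hu (hφ : (u 0).im = 0) => ?_⟩
      obtain ⟨r1, i1, r2, i2⟩ := hparts u hu
      simp at r1 i1 r2 i2
      exact hzero u (hcancel (1 + 2 * l₁) _ (by linarith) (by linarith)) hφ
        (hcancel (1 - 2 * l₂) _ (by linarith) (by linarith))
        (hcancel (1 + 2 * l₂) _ (by linarith) (by linarith))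
  · refine ⟨0, fun u hu _ => ?_⟩
    obtain ⟨r1, i1, r2, i2⟩ := hparts u hu
    simp at r1 i1 r2 i2
    have hl' : 1 + 4 * l ^ 2 ≠ 0 := by positivity
    exact hzero u (hcancel _ _ hl' (by linear_combination r1 - 2 * l * (-r2)))
      (hcancel _ _ hl' (by linear_combination i1 - 2 * l * i2))
      (hcancel _ _ hl' (by linear_combination -r2 + 2 * l * r1))
      (hcancel _ _ hl' (by linear_combination -i2 - 2 * l * i1))
  · refine ⟨0, fun u hu _ => ?_⟩
    obtain ⟨r1, i1, r2, i2⟩ := hparts u hu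
    simp at r1 i1 r2 i2
    apply hzero <;> linarith
  -- For b = 1/2 the coordinate Im u₀ is free.
  · refine ⟨im 0, fun u hu (hφ : (u 0).im = 0) => ?_⟩
    obtain ⟨r1, i1, r2, i2⟩ := hparts u hu
    simp [hφ] at r1 i1 r2 i2
    have hb' : 1 + 2 * b ≠ 0 := by positivity
    have hx : (u 1).re = 0 := hcancel _ _ hb' (by linarith)
    rw [hx] at r2
    exact hzero u (hcancel _ _ hb' (by linarith)) hφ hx (by linarith)
  · refine ⟨0, fun u hu _ => ?_⟩
    obtain ⟨r1, i1, r2, i2⟩ := hparts u hu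
    simp at r1 i1 r2 i2
    -- The first equation says u₁ = -ū₀; the second becomes (1 - 2d̄)u₀ = 0, and d is not real.
    have hx : (u 1).re = -(u 0).re := by linarith
    have hy : (u 1).im = (u 0).im := by linarith
    rw [hx, hy] at r2 i2
    have hsum : (u 0).re ^ 2 + (u 0).im ^ 2 = 0 := hcancel (2 * d.im) _ (by positivity)
      (by linear_combination (u 0).re * i2 - (u 0).im * r2)
    have h0 : (u 0).re = 0 := by nlinarith [sq_nonneg (u 0).re, sq_nonneg (u 0).im]
    have h0' : (u 0).im = 0 := by nlinarith [sq_nonneg (u 0).re, sq_nonneg (u 0).im]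
    exact hzero u h0 h0' (by rw [hx, h0, neg_zero]) (by rw [hy, h0'])

end NormalForms

/-! ### Differentiating the vanishing of the antilinear part. -/

section AntiPartCalculus

variable {Z : Type*} [NormedAddCommGroup Z] [NormedSpace ℂ Z] [NormedSpace ℝ Z]

/-- `D ↦ antiPart D v` as a continuous linear map. -/
noncomputable def antiPartAt (v : Z) : (Z →L[ℝ] ℂ) →L[ℝ] ℂ :=
  ContinuousLinearMap.apply ℝ ℂ v + Complex.I • ContinuousLinearMap.apply ℝ ℂ (Complex.I • v)

lemma antiPart_fderiv_eq_zero {Y : Type*} [NormedAddCommGroup Y] [NormedSpace ℝ Y] {y₀ : Y}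
    {F' : Z → Z →L[ℝ] ℂ} {H : Z →L[ℝ] Z →L[ℝ] ℂ} {g : Y → Z} {g' : Y →L[ℝ] Z} {v : Z}
    (hF : HasFDerivAt F' H (g y₀)) (hg : HasFDerivAt g g' y₀)
    (h : ∀ᶠ y in 𝓝 y₀, antiPart (F' (g y)) v = 0) (t : Y) : antiPart (H (g' t)) v = 0 := by
  have h1 : HasFDerivAt (fun y => antiPart (F' (g y)) v) _ y₀ :=
    (antiPartAt v).hasFDerivAt.comp y₀ (hF.comp y₀ hg)
  exact DFunLike.congr_fun (h1.unique ((hasFDerivAt_const (0 : ℂ) y₀).congr_of_eventuallyEq h)) t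

end AntiPartCalculus

/-! ### Slices by the planes V(τ). -/

section Slices

variable {M : Set CThree} {F : (Fin 2 → ℂ) → ℂ} {c a : Fin 2 → ℂ} {τ : ℂ}

lemma continuous_planeEmb : Continuous fun y : ℂ × ℂ × ℂ => planeEmb c a y.1 y.2 := by
  unfold planeEmb
  fun_prop

/-- The real linear map `ξ ↦ ξ • c`. -/
noncomputable def lineMap (c : Fin 2 → ℂ) : ℂ →L[ℝ] Fin 2 → ℂ :=
  (ContinuousLinearMap.toSpanSingleton ℂ c).restrictScalars ℝ

lemma lineMap_apply (c : Fin 2 → ℂ) (x : ℂ) : lineMap c x = x • c := rfl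

lemma antiPart_comp_lineMap (D : (Fin 2 → ℂ) →L[ℝ] ℂ) (c : Fin 2 → ℂ) :
    antiPart (D.comp (lineMap c)) 1 = antiPart D c := by
  simp [antiPart, lineMap_apply]

lemma hasFDerivAt_slice (x : ℂ) : HasFDerivAt (fun x => x • c + τ • a) (lineMap c) x :=
  (lineMap c).hasFDerivAt.add_const (τ • a)

lemma planeSlice_graph {x : ℂ × ℂ}
    (hM : ∀ᶠ q in 𝓝 (planeEmb c a τ x), q ∈ M ↔ q.2 = F q.1) :
    ∀ᶠ q in 𝓝 x, q ∈ planeSlice M c a τ ↔ q.2 = F (q.1 • c + τ • a) :=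
  ((continuous_planeEmb.comp (Continuous.prodMk_right τ)).tendsto x).eventually hM

lemma isComplexTangentPoint_planeSlice_iff {x : ℂ × ℂ}
    (hM : ∀ᶠ q in 𝓝 (planeEmb c a τ x), q ∈ M ↔ q.2 = F q.1)
    (hF : DifferentiableAt ℝ F (x.1 • c + τ • a)) :
    IsComplexTangentPoint (planeSlice M c a τ) x ↔
      x.2 = F (x.1 • c + τ • a) ∧ antiPart (fderiv ℝ F (x.1 • c + τ • a)) c = 0 := by
  rw [isComplexTangentPoint_graph_iff (planeSlice_graph hM)
    (hF.hasFDerivAt.comp x.1 (hasFDerivAt_slice x.1)), antiPart_comp_lineMap]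
  rfl

lemma isEllipticPoint_planeSlice {x : ℂ}
    (hM : ∀ᶠ q in 𝓝 (planeEmb c a τ (x, F (x • c + τ • a))), q ∈ M ↔ q.2 = F q.1)
    (hF : AnalyticAt ℝ F (x • c + τ • a)) (h0 : antiPart (fderiv ℝ F (x • c + τ • a)) c = 0)
    {H : (Fin 2 → ℂ) →L[ℝ] (Fin 2 → ℂ) →L[ℝ] ℂ} (hH : HasFDerivAt (fderiv ℝ F) H (x • c + τ • a))
    (hell : ‖H c c - H (Complex.I • c) (Complex.I • c) + 2 * Complex.I * H c (Complex.I • c)‖ <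
      ‖H c c + H (Complex.I • c) (Complex.I • c)‖) :
    IsEllipticPoint (planeSlice M c a τ) (x, F (x • c + τ • a)) := by
  have hcont : Tendsto (fun x => x • c + τ • a) (𝓝 x) (𝓝 (x • c + τ • a)) :=
    (hasFDerivAt_slice x).continuousAt
  have hsm : AnalyticAt ℝ (fun x => F (x • c + τ • a)) x :=
    AnalyticAt.comp (g := F) hF (((lineMap c).analyticAt x).add analyticAt_const)
  refine isEllipticPoint_graph (f := fun x => F (x • c + τ • a))
    (f' := fun x => (fderiv ℝ F (x • c + τ • a)).comp (lineMap c))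
    (H := ((ContinuousLinearMap.compL ℝ ℂ (Fin 2 → ℂ) ℂ).flip (lineMap c)).comp
      (H.comp (lineMap c)))
    (planeSlice_graph hM) hsm.contDiffAt ?_ ?_ ?_ ?_
  · filter_upwards [hcont.eventually hF.eventually_analyticAt] with y hy
    exact hy.differentiableAt.hasFDerivAt.comp y (hasFDerivAt_slice y)
  · exact ((ContinuousLinearMap.compL ℝ ℂ (Fin 2 → ℂ) ℂ).flip (lineMap c)).hasFDerivAt.comp x
      (hH.comp x (hasFDerivAt_slice x))
  · rw [antiPart_comp_lineMap, h0]
  · simpa [lineMap_apply] using hell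

end Slices

lemma exists_linearIndependent_pair {c : Fin 2 → ℂ} (hc : c ≠ 0) :
    ∃ a : Fin 2 → ℂ, LinearIndependent ℂ ![c, a] ∧
      ∀ v : Fin 2 → ℂ, ∃ x y : ℂ, v = x • c + y • a := by
  obtain ⟨a, ha⟩ := exists_linearIndependent_pair_of_one_lt_finrank (R := ℂ) (M := Fin 2 → ℂ)
    (by simp) hc
  refine ⟨a, ha, fun v => ?_⟩
  have hspan : Submodule.span ℂ (Set.range ![c, a]) = ⊤ :=
    ha.span_eq_top_of_card_eq_finrank (by simp)
  have hv : v ∈ Submodule.span ℂ {c, a} := by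
    rw [← Matrix.range_cons_cons_empty c a ![], hspan]
    trivial
  obtain ⟨x, y, h⟩ := Submodule.mem_span_pair.1 hv
  exact ⟨x, y, h.symm⟩

/-! ### CR points and CR singular points of a graph. -/

section CRPoints

variable {M : Set CThree} {F : (Fin 2 → ℂ) → ℂ}

lemma isCRPoint_graph {z₀ v : Fin 2 → ℂ}
    (hM : ∀ᶠ q in 𝓝 ((z₀, F z₀) : CThree), q ∈ M ↔ q.2 = F q.1) (hF : AnalyticAt ℝ F z₀)
    (hv : antiPart (fderiv ℝ F z₀) v ≠ 0) : IsCRPoint M (z₀, F z₀) := by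
  refine ⟨hM.self_of_nhds.2 rfl, ?_⟩
  have hfst : Tendsto (fun q : CThree => q.1) (𝓝 (z₀, F z₀)) (𝓝 z₀) := continuous_fst.tendsto _
  have hcont : ContinuousAt (fun z => antiPart (fderiv ℝ F z) v) z₀ :=
    (antiPartAt v).continuous.continuousAt.comp hF.fderiv.continuousAt
  have h0 := crRank_graph_of_antiPart_ne_zero (p := (z₀, F z₀)) rfl hM
    hF.differentiableAt.hasFDerivAt hv
  filter_upwards [self_mem_nhdsWithin, nhdsWithin_le_nhds hM.eventually_nhds,
    nhdsWithin_le_nhds (hfst.eventually hF.eventually_analyticAt),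
    nhdsWithin_le_nhds (hfst.eventually (hcont.eventually_ne hv))] with q hqM hq hqF hqv
  have h1 := crRank_graph_of_antiPart_ne_zero (hq.self_of_nhds.1 hqM) hq
    hqF.differentiableAt.hasFDerivAt hqv
  omega

/-- The rank is maximal at z₀. Were it constant nearby, ∂̄F would vanish identically near z₀, and so
would its derivative there, which H determines. -/
lemma isCRSingularPoint_graph {z₀ u v : Fin 2 → ℂ}
    {H : (Fin 2 → ℂ) →L[ℝ] (Fin 2 → ℂ) →L[ℝ] ℂ}
    (hM : ∀ᶠ q in 𝓝 ((z₀, F z₀) : CThree), q ∈ M ↔ q.2 = F q.1) (hF : AnalyticAt ℝ F z₀)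
    (h0 : fderiv ℝ F z₀ = 0) (hH : HasFDerivAt (fderiv ℝ F) H z₀) (hv : antiPart (H u) v ≠ 0) :
    IsCRSingularPoint M (z₀, F z₀) := by
  refine ⟨hM.self_of_nhds.2 rfl, fun hcr => hv ?_⟩
  have htend : Tendsto (fun z => (z, F z)) (𝓝 z₀) (𝓝 (z₀, F z₀)) :=
    tendsto_id.prodMk_nhds hF.continuousAt.tendsto
  have hrank0 : crRank M (z₀, F z₀) = _ := crRank_graph_of_antiPart_eq_zero rfl hM
    hF.differentiableAt.hasFDerivAt (fun v => by simp [h0, antiPart])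
  refine antiPart_fderiv_eq_zero hH (hasFDerivAt_id z₀) ?_ u
  filter_upwards [htend.eventually (eventually_nhdsWithin_iff.1 hcr.2),
    htend.eventually hM.eventually_nhds, hF.eventually_analyticAt] with z h1 h2 h3
  by_contra hne
  have h4 := crRank_graph_of_antiPart_ne_zero (p := (z, F z)) rfl h2
    h3.differentiableAt.hasFDerivAt hne
  have h5 := h1 (h2.self_of_nhds.2 rfl)
  omega

end CRPoints

/-- Solve `F_ξ̄(ξ c + τ a) = 0` for `ξ = p τ`. -/
lemma exists_analytic_complexTangent {F : (Fin 2 → ℂ) → ℂ} {c a : Fin 2 → ℂ}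
    (hF : AnalyticAt ℝ F 0) (h0 : fderiv ℝ F 0 = 0) {H : (Fin 2 → ℂ) →L[ℝ] (Fin 2 → ℂ) →L[ℝ] ℂ}
    (hH : HasFDerivAt (fderiv ℝ F) H 0) (hinj : ∀ x : ℂ, antiPart (H (x • c)) c = 0 → x = 0) :
    ∃ p : ℂ → ℂ, AnalyticAt ℝ p 0 ∧ p 0 = 0 ∧
      ∀ᶠ v in 𝓝 (0 : ℂ × ℂ), antiPart (fderiv ℝ F (v.2 • c + v.1 • a)) c = 0 ↔ p v.1 = v.2 := by
  let L : ℂ × ℂ →L[ℝ] Fin 2 → ℂ :=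
    (lineMap c).comp (ContinuousLinearMap.snd ℝ ℂ ℂ) + (lineMap a).comp (ContinuousLinearMap.fst ℝ ℂ ℂ)
  let ψ : ℂ × ℂ → ℂ := fun v => antiPart (fderiv ℝ F (v.2 • c + v.1 • a)) c
  have hψan : AnalyticAt ℝ ψ 0 := by
    have h1 : AnalyticAt ℝ (fderiv ℝ F) (L 0) := by rw [map_zero]; exact hF.fderiv
    exact ((antiPartAt c).analyticAt _).comp (h1.comp (L.analyticAt 0))
  have hψd : HasFDerivAt ψ ((antiPartAt c).comp (H.comp L)) 0 := by
    have h1 : HasFDerivAt (fderiv ℝ F) H (L 0) := by rw [map_zero]; exact hH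
    exact (antiPartAt c).hasFDerivAt.comp _ (h1.comp _ L.hasFDerivAt)
  have hψ0 : ψ 0 = 0 := by simp [ψ, h0, antiPart]
  have hcd : ContDiffAt ℝ ω ψ 0 := hψan.contDiffAt
  have hinv : (fderiv ℝ ψ 0 ∘L .inr ℝ ℂ ℂ).IsInvertible := by
    rw [hψd.fderiv]
    set T := ((antiPartAt c).comp (H.comp L)) ∘L .inr ℝ ℂ ℂ with hT
    -- An injective real endomorphism of ℂ is invertible, as the implicit function theorem requires.
    have hTi : Function.Injective (T : ℂ →ₗ[ℝ] ℂ) := by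
      rw [← LinearMap.ker_eq_bot, LinearMap.ker_eq_bot']
      intro x hx
      apply hinj
      have : T x = antiPart (H (x • c)) c := by
        change antiPart (H (x • c + (0 : ℂ) • a)) c = _
        rw [zero_smul, add_zero]
      rw [← this]
      exact hx
    exact ⟨(LinearEquiv.ofInjectiveEndo (T : ℂ →ₗ[ℝ] ℂ) hTi).toContinuousLinearEquiv, by
      ext; rfl⟩
  refine ⟨hcd.implicitFunction (by simp) hinv,
    (hcd.contDiffAt_implicitFunction (by simp) hinv).analyticAt,
    hcd.implicitFunction_apply_self (by simp) hinv, ?_⟩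
  have := hcd.eventually_apply_eq_iff_implicitFunction (by simp) hinv
  rwa [hψ0] at this

/-! ### Generic parameters and the main theorem. -/

section Generic

variable {F : (Fin 2 → ℂ) → ℂ} {c a : Fin 2 → ℂ} {p : ℂ → ℂ}

lemma frequently_antiPart_ne_zero {H : (Fin 2 → ℂ) →L[ℝ] (Fin 2 → ℂ) →L[ℝ] ℂ}
    (hH : HasFDerivAt (fderiv ℝ F) H 0) (hp : AnalyticAt ℝ p 0) (hp0 : p 0 = 0)
    (hca : LinearIndependent ℂ ![c, a]) (hspan : ∀ v : Fin 2 → ℂ, ∃ x y : ℂ, v = x • c + y • a)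
    (htan : ∀ᶠ τ in 𝓝 (0 : ℂ), antiPart (fderiv ℝ F (p τ • c + τ • a)) c = 0)
    {φ : (Fin 2 → ℂ) →ₗ[ℝ] ℝ} (hφ : ∀ u, (∀ v, antiPart (H u) v = 0) → φ u = 0 → u = 0) :
    ∃ᶠ τ in 𝓝 (0 : ℂ), antiPart (fderiv ℝ F (p τ • c + τ • a)) a ≠ 0 := by
  intro hcon
  set g' : ℂ →L[ℝ] Fin 2 → ℂ := (lineMap c).comp (fderiv ℝ p 0) + lineMap a with hg'
  have hg : HasFDerivAt (fun τ => p τ • c + τ • a) g' 0 :=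
    ((lineMap c).hasFDerivAt.comp 0 hp.differentiableAt.hasFDerivAt).add (lineMap a).hasFDerivAt
  have hH' : HasFDerivAt (fderiv ℝ F) H (p 0 • c + (0 : ℂ) • a) := by simpa [hp0] using hH
  have hker : ∀ t v, antiPart (H (g' t)) v = 0 := by
    intro t v
    refine antiPart_fderiv_eq_zero (g := fun τ => p τ • c + τ • a) hH' hg ?_ t
    filter_upwards [htan, hcon] with τ h1 h2
    obtain ⟨x, y, rfl⟩ := hspan v
    rw [antiPart_add, antiPart_smul, antiPart_smul, h1, not_not.1 h2]
    simp
  -- Dimension count: φ ∘ g' maps a real plane to a line, so some t ≠ 0 has φ(g' t) = 0, hence g' t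
  -- = 0. The a-component of g' t is t itself, which contradicts independence of c and a.
  have hbot : LinearMap.ker (φ ∘ₗ (g' : ℂ →ₗ[ℝ] Fin 2 → ℂ)) ≠ ⊥ :=
    LinearMap.ker_ne_bot_of_finrank_lt (by simp)
  obtain ⟨t, ht, ht0⟩ := Submodule.exists_mem_ne_zero_of_ne_bot hbot
  have hz : g' t = 0 := hφ _ (hker t) (by simpa using ht)
  have hz' : (fderiv ℝ p 0 t) • c + t • a = 0 := by
    simpa [hg', lineMap_apply] using hz
  exact ht0 (LinearIndependent.pair_iff.1 hca _ _ hz').2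

lemma analyticAt_normSq_antiPart {Z : Type*} [NormedAddCommGroup Z] [NormedSpace ℂ Z]
    [NormedSpace ℝ Z] {F : Z → ℂ} {g : ℂ → Z} {x : ℂ} (v : Z) (hF : AnalyticAt ℝ F (g x))
    (hg : AnalyticAt ℝ g x) :
    AnalyticAt ℝ (fun x => Complex.normSq (antiPart (fderiv ℝ F (g x)) v)) x := by
  have h1 : AnalyticAt ℝ (fun x => antiPart (fderiv ℝ F (g x)) v) x :=
    ((antiPartAt v).analyticAt _).comp (hF.fderiv.comp hg)
  have hre := (Complex.reCLM.analyticAt _).comp h1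
  have him := (Complex.imCLM.analyticAt _).comp h1
  exact (hre.mul hre).add (him.mul him)

end Generic

/-- The statement about slices for a graph over `ℂ²` whose second derivative `H` at `0` is
elliptic in the direction `c`. -/
theorem exists_elliptic_slices {M : Set CThree} {F : (Fin 2 → ℂ) → ℂ} (hF : AnalyticAt ℝ F 0)
    (hF0 : F 0 = 0) (hF1 : fderiv ℝ F 0 = 0) {H : (Fin 2 → ℂ) →L[ℝ] (Fin 2 → ℂ) →L[ℝ] ℂ}
    (hH : HasFDerivAt (fderiv ℝ F) H 0) (hM : ∀ᶠ q : CThree in 𝓝 0, q ∈ M ↔ q.2 = F q.1)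
    {c : Fin 2 → ℂ} (hinj : ∀ x : ℂ, antiPart (H (x • c)) c = 0 → x = 0)
    (hell : ‖H c c - H (Complex.I • c) (Complex.I • c) + 2 * Complex.I * H c (Complex.I • c)‖ <
      ‖H c c + H (Complex.I • c) (Complex.I • c)‖)
    {φ : (Fin 2 → ℂ) →ₗ[ℝ] ℝ} (hφ : ∀ u, (∀ v, antiPart (H u) v = 0) → φ u = 0 → u = 0) :
    IsEllipticDirection M c ∧
      ∃ a : Fin 2 → ℂ, LinearIndependent ℂ ![c, a] ∧
        ∃ P : ℂ → ℂ × ℂ,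
          Tendsto P (𝓝 0) (𝓝 0) ∧
          (∀ᶠ τ in 𝓝 (0 : ℂ), IsEllipticPoint (planeSlice M c a τ) (P τ)) ∧
          (∃ r : ℝ, 0 < r ∧ ∀ᶠ τ in 𝓝 (0 : ℂ), ∀ x ∈ Metric.ball (0 : ℂ × ℂ) r,
            (IsComplexTangentPoint (planeSlice M c a τ) x ↔ x = P τ)) ∧
          GenericNearZero (fun τ =>
            IsCRPoint M (planeEmb c a τ (P τ)) ∧
            ¬ HasHolomorphicCurveThrough M (planeEmb c a τ (P τ))) := by
  have hc : c ≠ 0 := by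
    rintro rfl
    simp at hell
  have hFt : ContinuousAt F 0 := hF.continuousAt
  have hgraph : Tendsto (fun z => ((z, F z) : CThree)) (𝓝 0) (𝓝 0) := by
    have : Tendsto (fun z => ((z, F z) : CThree)) (𝓝 0) (𝓝 (0, F 0)) :=
      tendsto_id.prodMk_nhds hFt.tendsto
    rwa [hF0] at this
  refine ⟨⟨?_, hc, ?_⟩, ?_⟩
  · have := isCRSingularPoint_graph (z₀ := 0) (u := c) (v := c) (by rwa [hF0]) hF hF1 hH
      (fun h => one_ne_zero (hinj 1 (by rwa [one_smul])))
    rwa [hF0] at this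
  · have := isEllipticPoint_planeSlice (M := M) (F := F) (c := c) (a := 0) (τ := 0) (x := 0)
      (H := H) (by simpa [hF0, planeEmb] using! hM) (by simpa using hF)
      (by simp [hF1, antiPart]) (by simpa using hH) hell
    simpa [hF0] using! this
  obtain ⟨a, hca, hspan⟩ := exists_linearIndependent_pair hc
  obtain ⟨p, hp, hp0, hpu⟩ := exists_analytic_complexTangent (a := a) hF hF1 hH hinj
  let ζ : ℂ → Fin 2 → ℂ := fun τ => p τ • c + τ • a
  have hζ0 : ζ 0 = 0 := by simp [ζ, hp0]
  have hζan : ∀ τ, AnalyticAt ℝ p τ → AnalyticAt ℝ ζ τ := fun τ h =>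
    (((lineMap c).analyticAt _).comp h).add ((lineMap a).analyticAt τ)
  have hζt : Tendsto ζ (𝓝 0) (𝓝 0) := by
    have := (hζan 0 hp).continuousAt.tendsto
    rwa [hζ0] at this
  have htan : ∀ᶠ τ in 𝓝 (0 : ℂ), antiPart (fderiv ℝ F (ζ τ)) c = 0 := by
    have hpt : Tendsto (fun τ => (τ, p τ)) (𝓝 0) (𝓝 (0 : ℂ × ℂ)) := by
      have : Tendsto (fun τ => (τ, p τ)) (𝓝 0) (𝓝 (0, p 0)) :=
        tendsto_id.prodMk_nhds hp.continuousAt.tendsto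
      rwa [hp0] at this
    filter_upwards [hpt.eventually hpu] with τ h
    exact h.2 rfl
  have hHan : AnalyticAt ℝ (fderiv ℝ (fderiv ℝ F)) 0 := hF.fderiv.fderiv
  have hH0 : fderiv ℝ (fderiv ℝ F) 0 = H := hH.fderiv
  have hHe : ∀ u v, ContinuousAt (fun z => fderiv ℝ (fderiv ℝ F) z u v) 0 := fun u v =>
    (hHan.continuousAt.clm_apply continuousAt_const).clm_apply continuousAt_const
  have hellnear : ∀ᶠ z in 𝓝 (0 : Fin 2 → ℂ),
      ‖fderiv ℝ (fderiv ℝ F) z c c - fderiv ℝ (fderiv ℝ F) z (Complex.I • c) (Complex.I • c) +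
        2 * Complex.I * fderiv ℝ (fderiv ℝ F) z c (Complex.I • c)‖ <
      ‖fderiv ℝ (fderiv ℝ F) z c c + fderiv ℝ (fderiv ℝ F) z (Complex.I • c) (Complex.I • c)‖ := by
    refine ContinuousAt.eventually_lt ?_ ?_ (by rw [hH0]; exact hell)
    · exact (((hHe _ _).sub (hHe _ _)).add (continuousAt_const.mul (hHe _ _))).norm
    · exact ((hHe _ _).add (hHe _ _)).norm
  have hMg : ∀ᶠ z in 𝓝 (0 : Fin 2 → ℂ), ∀ᶠ q in 𝓝 ((z, F z) : CThree), q ∈ M ↔ q.2 = F q.1 :=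
    hgraph.eventually hM.eventually_nhds
  refine ⟨a, hca, fun τ => (p τ, F (ζ τ)), ?_, ?_, ?_, ?_⟩
  · have h1 : Tendsto p (𝓝 0) (𝓝 0) := by simpa [hp0] using hp.continuousAt.tendsto
    have h2 : Tendsto (fun τ => F (ζ τ)) (𝓝 0) (𝓝 0) := by
      have := hFt.tendsto.comp hζt
      rwa [hF0] at this
    exact h1.prodMk_nhds h2
  · filter_upwards [htan, hζt.eventually hellnear, hζt.eventually hMg,
      hζt.eventually hF.eventually_analyticAt] with τ h1 h2 h3 h4
    exact isEllipticPoint_planeSlice h3 h4 h1 h4.fderiv.differentiableAt.hasFDerivAt h2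
  -- The equivalence is proved jointly in (τ, x) near 0; a product neighbourhood then yields a
  -- radius r independent of τ.
  · have hev : ∀ᶠ y in 𝓝 (0 : ℂ × ℂ × ℂ),
        (IsComplexTangentPoint (planeSlice M c a y.1) y.2 ↔ y.2 = (p y.1, F (ζ y.1))) := by
      have he : Tendsto (fun y : ℂ × ℂ × ℂ => planeEmb c a y.1 y.2) (𝓝 0) (𝓝 0) := by
        have := (continuous_planeEmb (c := c) (a := a)).tendsto 0
        simpa [planeEmb] using! this
      have he1 : Tendsto (fun y : ℂ × ℂ × ℂ => y.2.1 • c + y.1 • a) (𝓝 0) (𝓝 0) :=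
        (continuous_fst.tendsto _).comp he
      have he2 : Tendsto (fun y : ℂ × ℂ × ℂ => (y.1, y.2.1)) (𝓝 0) (𝓝 0) := by
        have : Continuous fun y : ℂ × ℂ × ℂ => (y.1, y.2.1) := by fun_prop
        exact this.tendsto 0
      filter_upwards [he.eventually hM.eventually_nhds, he1.eventually hF.eventually_analyticAt,
        he2.eventually hpu] with y h1 h2 h3
      rw [isComplexTangentPoint_planeSlice_iff h1 h2.differentiableAt, h3]
      constructor
      · rintro ⟨h4, h5⟩
        refine Prod.ext h5.symm ?_
        simp only [ζ]
        rw [h5, h4]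
      · intro h
        have h5 : p y.1 = y.2.1 := by rw [h]
        refine ⟨?_, h5⟩
        rw [← h5]
        exact congrArg Prod.snd h
    rw [show (0 : ℂ × ℂ × ℂ) = (0, 0) from rfl, nhds_prod_eq, eventually_prod_iff] at hev
    obtain ⟨pa, hpa, pb, hpb, hab⟩ := hev
    obtain ⟨r, hr, hball⟩ := Metric.eventually_nhds_iff_ball.1 hpb
    exact ⟨r, hr, hpa.mono fun τ h x hx => hab h (hball x hx)⟩
  · have hlevi : ∀ᶠ z in 𝓝 (0 : Fin 2 → ℂ), leviForm (fderiv ℝ (fderiv ℝ F) z) c ≠ 0 :=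
      hellnear.mono fun z h h' => by
        rw [leviForm] at h'
        rw [h', norm_zero] at h
        exact absurd h (not_lt.2 (norm_nonneg _))
    obtain ⟨δ, hδ, hball⟩ := Metric.eventually_nhds_iff_ball.1
      (htan.and (hp.eventually_analyticAt.and (hζt.eventually
        (hlevi.and (hMg.and hF.eventually_analyticAt)))))
    -- The exceptional set is where ∂̄F at ζ(τ) kills a as well as c, that is, where ∂̄F vanishes.
    refine ⟨δ, fun τ => Complex.normSq (antiPart (fderiv ℝ F (ζ τ)) a), hδ, ?_, ?_, ?_⟩
    · intro τ hτ
      obtain ⟨-, h2, -, -, h5⟩ := hball τ hτ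
      exact analyticAt_normSq_antiPart a h5 (hζan τ h2)
    · obtain ⟨τ, h1, h2⟩ := ((frequently_antiPart_ne_zero hH hp hp0 hca hspan htan hφ).and_eventually
        (Metric.ball_mem_nhds 0 hδ)).exists
      exact ⟨τ, h2, fun h => h1 (Complex.normSq_eq_zero.1 h)⟩
    · intro τ hτ hne
      obtain ⟨h1, -, h3, h4, h5⟩ := hball τ hτ
      have ha : antiPart (fderiv ℝ F (ζ τ)) a ≠ 0 := fun h =>
        hne (Complex.normSq_eq_zero.2 h)
      refine ⟨isCRPoint_graph h4 h5 ha, not_hasHolomorphicCurveThrough_graph h4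
        (h5.eventually_analyticAt.mono fun z h => h.differentiableAt.hasFDerivAt)
        (h5.fderiv.eventually_analyticAt.mono fun z h => h.differentiableAt.hasFDerivAt)
        h5.fderiv.fderiv.continuousAt hspan h1 ha h3⟩

theorem lemma132 (A B : Matrix (Fin 2) (Fin 2) ℂ) (hAB : IsCoffmanForm A B)
    (E : (Fin 2 → ℂ) → ℂ) (hE : AnalyticAt ℝ E 0)
    (hE3 : E =O[𝓝 0] fun z : Fin 2 → ℂ => ‖z‖ ^ 3)
    (M : Set CThree)
    (hM : ∀ᶠ p : CThree in 𝓝 0, p ∈ M ↔ p.2 = quadForm A B p.1 + E p.1) :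
    ∃ c : Fin 2 → ℂ, IsEllipticDirection M c ∧
      ∃ a : Fin 2 → ℂ, LinearIndependent ℂ ![c, a] ∧
        ∃ P : ℂ → ℂ × ℂ,
          Tendsto P (𝓝 0) (𝓝 0) ∧
          (∀ᶠ τ in 𝓝 (0 : ℂ), IsEllipticPoint (planeSlice M c a τ) (P τ)) ∧
          (∃ r : ℝ, 0 < r ∧ ∀ᶠ τ in 𝓝 (0 : ℂ), ∀ x ∈ Metric.ball (0 : ℂ × ℂ) r,
            (IsComplexTangentPoint (planeSlice M c a τ) x ↔ x = P τ)) ∧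
          GenericNearZero (fun τ =>
            IsCRPoint M (planeEmb c a τ (P τ)) ∧
            ¬ HasHolomorphicCurveThrough M (planeEmb c a τ (P τ))) := by
  obtain ⟨c, hc⟩ := hAB.exists_direction
  obtain ⟨φ, hφ⟩ := hAB.exists_functional
  obtain ⟨hE0, hE1, hE2⟩ := hE.second_order_vanishing hE3
  have hF : AnalyticAt ℝ (fun z => quadForm A B z + E z) 0 := (analyticAt_quadForm A B 0).add hE
  have hfd : ∀ᶠ z in 𝓝 (0 : Fin 2 → ℂ),
      fderiv ℝ (fun z => quadForm A B z + E z) z = polarForm A B z + fderiv ℝ E z := by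
    filter_upwards [hE.eventually_analyticAt] with z hz
    exact ((hasFDerivAt_quadForm A B z).add hz.differentiableAt.hasFDerivAt).fderiv
  have hH : HasFDerivAt (fderiv ℝ fun z => quadForm A B z + E z) (polarForm A B) 0 := by
    have := ((polarForm A B).hasFDerivAt (x := 0)).add hE2
    rw [add_zero] at this
    exact this.congr_of_eventuallyEq hfd
  refine ⟨c, exists_elliptic_slices hF ?_ ?_ hH hM ?_ ?_ hφ⟩
  · simp [quadForm, hE0]
  · rw [hfd.self_of_nhds, hE1, map_zero, add_zero]
  -- A solution x satisfies |x||cBc̄ᵗ| = 2|x||cAcᵗ|, so the strict inequality for c forces x = 0.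
  · intro x hx
    rw [antiPart_polarForm] at hx
    simp only [smul_dotProduct, Matrix.mulVec_smul, dotProduct_smul, smul_eq_mul, map_mul] at hx
    have h1 : x * (c ⬝ᵥ (B *ᵥ star c)) = -(conj x * (2 * conj (c ⬝ᵥ (A *ᵥ c)))) := by
      linear_combination (1 / 2) * hx
    have h2 := congrArg norm h1
    rw [norm_neg, norm_mul, norm_mul, norm_mul, RCLike.norm_conj, RCLike.norm_conj,
      Complex.norm_ofNat] at h2
    by_contra hx0
    exact hc.ne' (mul_left_cancel₀ (norm_ne_zero_iff.2 hx0) h2)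
  · rw [polarForm_levi, polarForm_antiHessian, norm_mul, norm_mul, RCLike.norm_conj,
      Complex.norm_ofNat, Complex.norm_ofNat]
    linarith
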